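/- Let $R$ be a commutative ring with identity, and let $\mathcal Z$ be a non-empty class of finite groups closed under direct products and under subquotients (the image of any homomorphism from a subgroup of a group in $\mathcal Z$ is in $\mathcal Z$). Let $\Omega_{R,\mathcal Z}$ be the biset category: its objects are the groups in $\mathcal Z$, the morphisms from $G$ to $H$ are the elements of $RB(H,G)=R\otimes_{\mathbb Z}B(H,G)$, where $B(H,G)$ is the Grothendieck group of finite $(H,G)$-bisets under disjoint union, and composition is induced by $V\times_H U$. A biset functor is an $R$-linear functor $\Omega_{R,\mathcal Z}\to R\text{-Mod}$. A Green biset functor $A$ is a biset functor with $R$-bilinear products $A(G)\times A(H)\to A(G\times H)$, $(a,b)\mapsto a\times b$, and an element $\varepsilon_A\in A(1)$, such that the products are associative and unital with unit $\varepsilon_A$ (up to the canonical isomorphisms $G\times(H\times K)\cong(G\times H)\times K$ and $1\times G\cong G\cong G\times 1$) and $A(\varphi\times\psi)(a\times b)=A(\varphi)(a)\times A(\psi)(b)$ for all morphisms $\varphi,\psi$ of $\Omega_{R,\mathcal Z}$. An $A$-module is a biset functor $M$ with $R$-bilinear products $A(G)\times M(H)\to M(G\times H)$ that satisfy the same associativity,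 left unit and functoriality conditions. It is simple if it is non-zero and its only submodules (families of $R$-submodules $N(G)\subseteq M(G)$ stable under all $M(\varphi)$ and under the products with elements of $A$) are $0$ and $M$. For $\beta\in A(H\times G)$ and $\alpha\in A(G\times K)$ put $\beta\circ\alpha=A(H\times\overleftarrow{G}\times K)(\beta\times\alpha)\in A(H\times K)$, and for $\alpha\in A(H\times G)$ and $m\in M(G)$ put $\alpha\cdot m=M(H\times\overleftarrow{G})(\alpha\times m)\in M(H)$, where $\overleftarrow{G}$ is the $(1,G\times G)$-biset $G$ with $x\cdot(g,g')=g^{-1}xg'$, and where $H$ and $K$ stand for the bisets that are the identity morphisms of these groups. With $\circ$ as multiplication, $A(H\times H)$ is an $R$-algebra, whose identity is the image of $\varepsilon_A$ under the $(H\times H,1)$-biset $H$ with $(h,h')\cdot x=hxh'^{-1}$, and $M(H)$ is an $A(H\times H)$-module. Let $I_A(H)$ be the submodule of $A(H\times H)$ generated by the elements $a\circ b$ with $a\in A(H\times K)$, $b\in A(K\times H)$, $K\in\mathcal Z$ and $|K|<|H|$. It is a two-sided ideal; let $\hat A(H)=A(H\times H)/I_A(H)$ be the quotient algebra. A group $H\in\mathcal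 Z$ is called minimal for $M$ if $M(H)\neq0$ and $M(K)=0$ for every $K\in\mathcal Z$ with $|K|<|H|$. **Lemma.** Let $A$ be a Green biset functor defined on $\Omega_{R,\mathcal Z}$ and let $S$ be a simple $A$-module. If $H\in\mathcal Z$ is a minimal group for $S$, then $\hat A(H)\neq 0$, the action of $A(H\times H)$ on $S(H)$ induces an $\hat A(H)$-module structure on $S(H)$, and with this structure $S(H)$ is a simple $\hat A(H)$-module. -/

import Mathlib

open CategoryTheory
open scoped TensorProduct RightActions

universe u v w w'

/-! ### Finite bisets -/

/-- A finite `(H, G)`-biset: a finite set with a left action of `H` and a right action of `G`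
(that is, an action of the opposite group of `G`) that commute. -/
structure Biset (H G : Type u) [Group H] [Group G] : Type (u + 1) where
  carrier : Type u
  [finite : Finite carrier]
  [left : MulAction H carrier]
  [right : MulAction Gᵐᵒᵖ carrier]
  [comm : SMulCommClass H Gᵐᵒᵖ carrier]

namespace Biset

section Basic

variable {H G K L H' G' : Type u} [Group H] [Group G] [Group K] [Group L] [Group H'] [Group G']

instance : CoeSort (Biset H G) (Type u) := ⟨Biset.carrier⟩

instance (U : Biset H G) : Finite U := U.finite
instance (U : Biset H G) : MulAction H U := U.left
instance (U : Biset H G) : MulAction Gᵐᵒᵖ U := U.right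
instance (U : Biset H G) : SMulCommClass H Gᵐᵒᵖ U := U.comm

/-- Two bisets are isomorphic: there is a bijection compatible with both actions. -/
def Isom (U V : Biset H G) : Prop :=
  ∃ e : U ≃ V, (∀ (h : H) (x : U), e (h • x) = h • e x) ∧
    ∀ (g : G) (x : U), e (x <• g) = e x <• g

theorem Isom.refl (U : Biset H G) : Isom U U := ⟨Equiv.refl _, fun _ _ => rfl, fun _ _ => rfl⟩

theorem Isom.symm {U V : Biset H G} : Isom U V → Isom V U := by
  rintro ⟨e, h1, h2⟩
  refine ⟨e.symm, fun h x => ?_, fun g x => ?_⟩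
  · rw [Equiv.symm_apply_eq, h1, Equiv.apply_symm_apply]
  · rw [Equiv.symm_apply_eq, h2, Equiv.apply_symm_apply]

theorem Isom.trans {U V W : Biset H G} : Isom U V → Isom V W → Isom U W := by
  rintro ⟨e, h1, h2⟩ ⟨f, h3, h4⟩
  exact ⟨e.trans f, fun h x => by simp [h1, h3], fun g x => by simp [h2, h4]⟩

theorem Isom.of_bijective {U V : Biset H G} (f : U → V) (hf : Function.Bijective f)
    (hl : ∀ (h : H) (x : U), f (h • x) = h • f x)
    (hr : ∀ (g : G) (x : U), f (x <• g) = f x <• g) : Isom U V :=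
  ⟨Equiv.ofBijective f hf, hl, hr⟩

/-- The setoid of isomorphism of bisets. -/
instance setoid (H G : Type u) [Group H] [Group G] : Setoid (Biset H G) where
  r := Isom
  iseqv := ⟨Isom.refl, Isom.symm, Isom.trans⟩

/-- A finite biset from a left action `l` and a right action `r` given as functions. -/
def ofFun (X : Type u) [Finite X] (l : H → X → X) (r : X → G → X)
    (l_one : ∀ x, l 1 x = x) (l_mul : ∀ (a b : H) (x : X), l (a * b) x = l a (l b x))
    (r_one : ∀ x, r x 1 = x) (r_mul : ∀ x a b, r x (a * b) = r (r x a) b)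
    (l_r : ∀ a x b, l a (r x b) = r (l a x) b) : Biset H G :=
  letI il : MulAction H X := { smul := l, one_smul := l_one, mul_smul := l_mul }
  letI ir : MulAction Gᵐᵒᵖ X :=
    { smul := fun g x => r x g.unop, one_smul := r_one, mul_smul := fun _ _ x => r_mul x _ _ }
  { carrier := X
    left := il
    right := ir
    comm := ⟨fun a b x => l_r a x b.unop⟩ }

/-- The empty biset. -/
def empty (H G : Type u) [Group H] [Group G] : Biset H G :=
  ofFun PEmpty (fun _ x => x) (fun x _ => x) (fun _ => rfl) (fun _ _ _ => rfl) (fun _ => rfl)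
    (fun _ _ _ => rfl) (fun _ _ _ => rfl)

/-- The disjoint union of two bisets. -/
def union (U V : Biset H G) : Biset H G where
  carrier := U ⊕ V
  left := { one_smul := by rintro (x | x) <;> simp
            mul_smul := by rintro a b (x | x) <;> simp [mul_smul] }
  right := { one_smul := by rintro (x | x) <;> simp
             mul_smul := by rintro a b (x | x) <;> simp [mul_smul] }

/-- The `(G, G)`-biset `G`, with its left and right multiplications. -/
def idBiset (G : Type u) [Group G] [Finite G] : Biset G G where
  carrier := G

/-- The equivalence relation on `V × U` whose classes are the orbits of the right action
`(v, u) · h = (v · h, h⁻¹ · u)` of `H`. -/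
def compSetoid (V : Biset K H) (U : Biset H G) : Setoid (V × U) where
  r p q := ∃ h : H, q = (p.1 <• h, h⁻¹ • p.2)
  iseqv := by
    refine ⟨fun p => ⟨1, by simp⟩, ?_, ?_⟩
    · rintro p q ⟨h, rfl⟩
      exact ⟨h⁻¹, by simp [smul_smul]⟩
    · rintro p q r ⟨h, rfl⟩ ⟨h', rfl⟩
      exact ⟨h * h', by simp [smul_smul]⟩

/-- The composition `V ×_H U` of a `(K, H)`-biset `V` and an `(H, G)`-biset `U`: the set of
`H`-orbits on `V × U`, with the `(K, G)`-biset structure `k · [v, u] · g = [k · v, u · g]`. -/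
def comp (V : Biset K H) (U : Biset H G) : Biset K G :=
  ofFun (Quotient (compSetoid V U))
    (fun k => Quotient.map (fun p => (k • p.1, p.2)) (by
      rintro p q ⟨h, rfl⟩
      exact ⟨h, by simp [smul_comm]⟩))
    (fun x g => Quotient.map (fun p => (p.1, p.2 <• g)) (by
      rintro p q ⟨h, rfl⟩
      exact ⟨h, by simp [smul_comm]⟩) x)
    (by
      rintro ⟨p⟩
      exact congrArg (Quotient.mk _) (by simp))
    (by
      rintro a b ⟨p⟩
      exact congrArg (Quotient.mk _) (by simp [mul_smul]))
    (by
      rintro ⟨p⟩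
      exact congrArg (Quotient.mk _) (by simp))
    (by
      rintro ⟨p⟩ a b
      exact congrArg (Quotient.mk _) (by simp [mul_smul]))
    (by
      rintro k ⟨p⟩ g
      rfl)

/-- The class of the pair `(v, u)` in `V ×_H U`. -/
def pair {V : Biset K H} {U : Biset H G} (v : V) (u : U) : comp V U :=
  Quotient.mk (compSetoid V U) (v, u)

/-- The product `U × U'` of an `(H, G)`-biset and an `(H', G')`-biset, an
`(H × H', G × G')`-biset for the componentwise actions. -/
def prod (U : Biset H G) (U' : Biset H' G') : Biset (H × H') (G × G') :=
  ofFun (U × U') (fun h p => (h.1 • p.1, h.2 • p.2)) (fun p g => (p.1 <• g.1, p.2 <• g.2))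
    (fun p => by simp) (fun a b p => by simp [mul_smul]) (fun p => by simp)
    (fun p a b => by simp [mul_smul]) (fun a p b => by simp [smul_comm])

/-- For a group isomorphism `f : G ≃* H`, the `(H, G)`-biset `H` with left action by
multiplication and right action by multiplication through `f`. -/
def iso [Finite H] (f : G ≃* H) : Biset H G :=
  ofFun H (fun h x => h * x) (fun x g => x * f g) (fun x => by simp) (fun a b x => by simp [mul_assoc])
    (fun x => by simp) (fun x a b => by simp [mul_assoc]) (fun a x b => by simp [mul_assoc])

/-! Actions in the bisets above. -/

@[simp] theorem smul_inl {U V : Biset H G} (h : H) (x : U) :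
    h • (Sum.inl x : union U V) = (Sum.inl (h • x) : union U V) := rfl
@[simp] theorem smul_inr {U V : Biset H G} (h : H) (x : V) :
    h • (Sum.inr x : union U V) = (Sum.inr (h • x) : union U V) := rfl
@[simp] theorem inl_smul {U V : Biset H G} (g : Gᵐᵒᵖ) (x : U) :
    g • (Sum.inl x : union U V) = (Sum.inl (g • x) : union U V) := rfl
@[simp] theorem inr_smul {U V : Biset H G} (g : Gᵐᵒᵖ) (x : V) :
    g • (Sum.inr x : union U V) = (Sum.inr (g • x) : union U V) := rfl

theorem pair_surjective {V : Biset K H} {U : Biset H G} (p : comp V U) :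
    ∃ v u, p = pair v u := by
  obtain ⟨⟨v, u⟩, rfl⟩ := Quotient.exists_rep p
  exact ⟨v, u, rfl⟩

theorem smul_pair {V : Biset K H} {U : Biset H G} (k : K) (v : V) (u : U) :
    k • (pair v u) = pair (k • v) u := rfl
theorem pair_smul {V : Biset K H} {U : Biset H G} (g : Gᵐᵒᵖ) (v : V) (u : U) :
    g • (pair v u) = pair v (g • u) := rfl

theorem pair_eq_iff {V : Biset K H} {U : Biset H G} {v v' : V} {u u' : U} :
    pair v u = pair v' u' ↔ ∃ h : H, v' = v <• h ∧ u = h • u' := by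
  refine ⟨fun e => ?_, ?_⟩
  · obtain ⟨h, hh⟩ := Quotient.exact e
    obtain ⟨h1, h2⟩ := Prod.ext_iff.1 hh
    exact ⟨h, h1, (inv_smul_eq_iff.1 h2.symm)⟩
  · rintro ⟨h, rfl, rfl⟩
    exact Quotient.sound ⟨h, by simp⟩

theorem pair_balanced {V : Biset K H} {U : Biset H G} (v : V) (h : H) (u : U) :
    pair (v <• h) u = pair v (h • u) := (pair_eq_iff.2 ⟨h, rfl, rfl⟩).symm

/-- Descend a balanced function to `V ×_H U`. -/
def compLift {V : Biset K H} {U : Biset H G} {X : Type*} (f : V → U → X)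
    (hf : ∀ v (h : H) u, f (v <• h) u = f v (h • u)) : comp V U → X :=
  Quotient.lift (fun p : V × U => f p.1 p.2) (by
    rintro p q ⟨h, rfl⟩
    simp [hf])

@[simp] theorem compLift_pair {V : Biset K H} {U : Biset H G} {X : Type*} (f : V → U → X)
    (hf : ∀ v (h : H) u, f (v <• h) u = f v (h • u)) (v : V) (u : U) :
    compLift f hf (pair v u) = f v u := rfl

/-- Recognition of a composition of bisets. -/
theorem comp_isom {V : Biset K H} {U : Biset H G} {W : Biset K G} (f : V → U → W)
    (hf : ∀ v (h : H) u, f (v <• h) u = f v (h • u))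
    (hl : ∀ (k : K) v u, f (k • v) u = k • f v u)
    (hr : ∀ (g : G) v u, f v (u <• g) = f v u <• g)
    (hs : ∀ w, ∃ v u, f v u = w)
    (hi : ∀ v u v' u', f v u = f v' u' → ∃ h : H, v' = v <• h ∧ u = h • u') :
    Isom (comp V U) W := by
  refine Isom.of_bijective (compLift f hf) ⟨fun p q hpq => ?_, fun w => ?_⟩ (fun k p => ?_)
    (fun g p => ?_)
  · obtain ⟨v, u, rfl⟩ := pair_surjective p
    obtain ⟨v', u', rfl⟩ := pair_surjective q
    exact pair_eq_iff.2 (hi _ _ _ _ hpq)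
  · obtain ⟨v, u, h⟩ := hs w
    exact ⟨pair v u, h⟩
  · obtain ⟨v, u, rfl⟩ := pair_surjective p
    exact hl k v u
  · obtain ⟨v, u, rfl⟩ := pair_surjective p
    exact hr g v u

/-! Compatibility of the operations with isomorphisms, disjoint unions and the empty biset. -/

theorem union_congr {U U' V V' : Biset H G} :
    Isom U U' → Isom V V' → Isom (union U V) (union U' V') := by
  rintro ⟨e, h1, h2⟩ ⟨f, h3, h4⟩
  refine ⟨Equiv.sumCongr e f, ?_, ?_⟩
  · rintro h (x | x)
    · exact congrArg Sum.inl (h1 h x)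
    · exact congrArg Sum.inr (h3 h x)
  · rintro h (x | x)
    · exact congrArg Sum.inl (h2 h x)
    · exact congrArg Sum.inr (h4 h x)

theorem union_comm (U V : Biset H G) : Isom (union U V) (union V U) := by
  refine ⟨Equiv.sumComm U V, ?_, ?_⟩ <;> rintro h (x | x) <;> rfl

theorem union_assoc (U V W : Biset H G) :
    Isom (union (union U V) W) (union U (union V W)) := by
  refine ⟨Equiv.sumAssoc U V W, ?_, ?_⟩ <;> rintro h ((x | x) | x) <;> rfl

theorem empty_union (U : Biset H G) : Isom (union (empty H G) U) U := by
  refine ⟨Equiv.emptySum PEmpty U, ?_, ?_⟩ <;> rintro h (x | x)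
  · exact x.elim
  · rfl
  · exact x.elim
  · rfl

theorem comp_congr {V V' : Biset K H} {U U' : Biset H G} :
    Isom V V' → Isom U U' → Isom (comp V U) (comp V' U') := by
  rintro ⟨e, h1, h2⟩ ⟨f, h3, h4⟩
  refine comp_isom (fun v u => pair (e v) (f u)) ?_ ?_ ?_ ?_ ?_
  · intro v h u
    rw [h2, h3, pair_balanced]
  · intro k v u
    rw [h1, smul_pair]
  · intro g v u
    rw [h4, pair_smul]
  · intro w
    obtain ⟨v, u, rfl⟩ := pair_surjective w
    exact ⟨e.symm v, f.symm u, by simp⟩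
  · intro v u v' u' hh
    obtain ⟨h, hv, hu⟩ := pair_eq_iff.1 hh
    exact ⟨h, e.injective (by rw [hv, h2]), f.injective (by rw [hu, h3])⟩

theorem comp_union (V : Biset K H) (U U' : Biset H G) :
    Isom (comp V (union U U')) (union (comp V U) (comp V U')) := by
  refine comp_isom (W := union (comp V U) (comp V U'))
    (fun v (u : U ⊕ U') => (Sum.map (pair v) (pair v) u : comp V U ⊕ comp V U')) ?_ ?_ ?_ ?_ ?_
  · rintro v h (u | u)
    · exact congrArg Sum.inl (pair_balanced v h u)
    · exact congrArg Sum.inr (pair_balanced v h u)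
  · rintro k v (u | u) <;> rfl
  · rintro k v (u | u) <;> rfl
  · rintro (w | w) <;> obtain ⟨v, u, rfl⟩ := pair_surjective w
    · exact ⟨v, Sum.inl u, rfl⟩
    · exact ⟨v, Sum.inr u, rfl⟩
  · rintro v (u | u) v' (u' | u') hh
    · obtain ⟨h, hv, hu⟩ := pair_eq_iff.1 (Sum.inl.inj hh)
      exact ⟨h, hv, congrArg Sum.inl hu⟩
    · cases hh
    · cases hh
    · obtain ⟨h, hv, hu⟩ := pair_eq_iff.1 (Sum.inr.inj hh)
      exact ⟨h, hv, congrArg Sum.inr hu⟩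

theorem union_comp (V V' : Biset K H) (U : Biset H G) :
    Isom (comp (union V V') U) (union (comp V U) (comp V' U)) := by
  refine comp_isom (W := union (comp V U) (comp V' U))
    (fun (v : V ⊕ V') u => (Sum.map (pair · u) (pair · u) v : comp V U ⊕ comp V' U)) ?_ ?_ ?_ ?_ ?_
  · rintro (v | v) h u
    · exact congrArg Sum.inl (pair_balanced v h u)
    · exact congrArg Sum.inr (pair_balanced v h u)
  · rintro k (v | v) u <;> rfl
  · rintro k (v | v) u <;> rfl
  · rintro (w | w) <;> obtain ⟨v, u, rfl⟩ := pair_surjective w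
    · exact ⟨Sum.inl v, u, rfl⟩
    · exact ⟨Sum.inr v, u, rfl⟩
  · rintro (v | v) u (v' | v') u' hh
    · obtain ⟨h, hv, hu⟩ := pair_eq_iff.1 (Sum.inl.inj hh)
      exact ⟨h, congrArg Sum.inl hv, hu⟩
    · cases hh
    · cases hh
    · obtain ⟨h, hv, hu⟩ := pair_eq_iff.1 (Sum.inr.inj hh)
      exact ⟨h, congrArg Sum.inr hv, hu⟩

theorem comp_empty (V : Biset K H) : Isom (comp V (empty H G)) (empty K G) :=
  comp_isom (fun _ u => u) (fun _ _ u => PEmpty.elim u) (fun _ _ u => PEmpty.elim u)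
    (fun _ _ u => PEmpty.elim u) (fun u => PEmpty.elim u) (fun _ u => PEmpty.elim u)

theorem empty_comp (U : Biset H G) : Isom (comp (empty K H) U) (empty K G) :=
  comp_isom (fun v _ => v) (fun v => PEmpty.elim v) (fun _ v => PEmpty.elim v)
    (fun _ v => PEmpty.elim v) (fun v => PEmpty.elim v) (fun v => PEmpty.elim v)

theorem comp_assoc (W : Biset L K) (V : Biset K H) (U : Biset H G) :
    Isom (comp (comp W V) U) (comp W (comp V U)) := by
  refine comp_isom (fun p u => compLift (fun w v => pair w (pair v u)) ?_ p) ?_ ?_ ?_ ?_ ?_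
  · intro w k v
    rw [pair_balanced, smul_pair]
  · intro p h u
    obtain ⟨w, v, rfl⟩ := pair_surjective p
    simp only [pair_smul, compLift_pair, pair_balanced]
  · intro l p u
    obtain ⟨w, v, rfl⟩ := pair_surjective p
    rfl
  · intro g p u
    obtain ⟨w, v, rfl⟩ := pair_surjective p
    rfl
  · intro q
    obtain ⟨w, r, rfl⟩ := pair_surjective q
    obtain ⟨v, u, rfl⟩ := pair_surjective r
    exact ⟨pair w v, u, rfl⟩
  · intro p u p' u' hh
    obtain ⟨w, v, rfl⟩ := pair_surjective p
    obtain ⟨w', v', rfl⟩ := pair_surjective p'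
    simp only [compLift_pair] at hh
    obtain ⟨k, rfl, hk⟩ := pair_eq_iff.1 hh
    rw [smul_pair] at hk
    obtain ⟨h, hv, rfl⟩ := pair_eq_iff.1 hk
    refine ⟨h, ?_, rfl⟩
    rw [pair_smul, ← hv, pair_balanced]

theorem id_comp [Finite H] (U : Biset H G) : Isom (comp (idBiset H) U) U := by
  refine comp_isom (V := idBiset H) (fun (h : H) u => h • u) ?_ ?_ ?_ ?_ ?_
  · intro (h : H) (h' : H) u
    exact mul_smul h h' u
  · intro (h : H) (h' : H) u
    exact mul_smul h h' u
  · intro g h u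
    exact (smul_comm _ _ _)
  · intro u
    exact ⟨(1 : H), u, one_smul H u⟩
  · intro (h : H) u (h' : H) u' hh
    refine ⟨h⁻¹ * h', (mul_inv_cancel_left h h').symm, ?_⟩
    simp only [mul_smul, ← hh, inv_smul_smul]

theorem comp_id [Finite G] (U : Biset H G) : Isom (comp U (idBiset G)) U := by
  refine comp_isom (fun u (g : G) => u <• g) ?_ ?_ ?_ ?_ ?_
  · intro u g g'
    exact (mul_smul _ _ _).symm
  · intro h u g
    exact (smul_comm _ _ _).symm
  · intro g u g'
    exact mul_smul (MulOpposite.op g) (MulOpposite.op _) u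
  · intro u
    exact ⟨u, (1 : G), one_smul Gᵐᵒᵖ u⟩
  · intro u (g : G) u' (g' : G) hh
    refine ⟨g * g'⁻¹, ?_, (inv_mul_cancel_right g g').symm⟩
    simp only [MulOpposite.op_mul, mul_smul, hh]
    simp

theorem prod_congr {U V : Biset H G} {U' V' : Biset H' G'} :
    Isom U V → Isom U' V' → Isom (prod U U') (prod V V') := by
  rintro ⟨e, h1, h2⟩ ⟨f, h3, h4⟩
  refine Isom.of_bijective (U := prod U U') (V := prod V V')
    (fun x : U × U' => ((e x.1, f x.2) : V × V')) (Equiv.prodCongr e f).bijective ?_ ?_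
  · rintro h (x : U × U')
    exact Prod.ext (h1 h.1 x.1) (h3 h.2 x.2)
  · rintro h (x : U × U')
    exact Prod.ext (h2 h.1 x.1) (h4 h.2 x.2)

theorem prod_union (U : Biset H G) (V V' : Biset H' G') :
    Isom (prod U (union V V')) (union (prod U V) (prod U V')) := by
  refine Isom.of_bijective (U := prod U (union V V')) (V := union (prod U V) (prod U V'))
    (Equiv.prodSumDistrib U V V') (Equiv.bijective _) ?_ ?_ <;>
  · intro h (x : U × (V ⊕ V'))
    obtain ⟨x, (y | y)⟩ := x <;> rfl

theorem union_prod (U U' : Biset H G) (V : Biset H' G') :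
    Isom (prod (union U U') V) (union (prod U V) (prod U' V)) := by
  refine Isom.of_bijective (U := prod (union U U') V) (V := union (prod U V) (prod U' V))
    (Equiv.sumProdDistrib U U' V) (Equiv.bijective _) ?_ ?_ <;>
  · intro h (x : (U ⊕ U') × V)
    obtain ⟨(x | x), y⟩ := x <;> rfl

theorem prod_empty (U : Biset H G) : Isom (prod U (empty H' G')) (empty (H × H') (G × G')) :=
  Isom.of_bijective (U := prod U (empty H' G')) (V := empty (H × H') (G × G'))
    (Equiv.prodPEmpty U) (Equiv.bijective _)
    (fun _ (x : U × PEmpty) => x.2.elim) (fun _ (x : U × PEmpty) => x.2.elim)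

theorem empty_prod (V : Biset H' G') : Isom (prod (empty H G) V) (empty (H × H') (G × G')) :=
  Isom.of_bijective (U := prod (empty H G) V) (V := empty (H × H') (G × G'))
    (Equiv.pemptyProd V) (Equiv.bijective _)
    (fun _ (x : PEmpty × V) => x.1.elim) (fun _ (x : PEmpty × V) => x.1.elim)

end Basic

end Biset

/-! ### The modules `RB(H, G)` -/

/-- The isomorphism classes of finite `(H, G)`-bisets. -/
def BisetClass (H G : Type u) [Group H] [Group G] : Type (u + 1) :=
  Quotient (Biset.setoid H G)

namespace BisetClass

variable {A B C D E F : Type u} [Group A] [Group B] [Group C] [Group D] [Group E] [Group F]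

/-- The isomorphism class of a biset. -/
def mk (U : Biset A B) : BisetClass A B := Quotient.mk _ U

theorem mk_eq {U V : Biset A B} (h : Biset.Isom U V) : mk U = mk V := Quotient.sound h

theorem mk_surjective (x : BisetClass A B) : ∃ U, x = mk U := by
  obtain ⟨U, rfl⟩ := Quotient.exists_rep x
  exact ⟨U, rfl⟩

/-- Isomorphism classes of bisets form a commutative monoid under disjoint union. -/
instance : Zero (BisetClass A B) := ⟨mk (Biset.empty A B)⟩

instance : Add (BisetClass A B) :=
  ⟨Quotient.map₂ Biset.union fun _ _ h _ _ h' => Biset.union_congr h h'⟩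

instance : AddCommMonoid (BisetClass A B) where
  add_assoc := by
    rintro ⟨U⟩ ⟨V⟩ ⟨W⟩
    exact mk_eq (Biset.union_assoc U V W)
  add_comm := by
    rintro ⟨U⟩ ⟨V⟩
    exact mk_eq (Biset.union_comm U V)
  zero_add := by
    rintro ⟨U⟩
    exact mk_eq (Biset.empty_union U)
  add_zero := by
    rintro ⟨U⟩
    exact mk_eq ((Biset.union_comm _ _).trans (Biset.empty_union U))
  nsmul := nsmulRec

theorem mk_add (U V : Biset A B) : mk U + mk V = mk (Biset.union U V) := rfl

/-- A biadditive map on isomorphism classes from a binary operation on bisets that respects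
isomorphisms, disjoint unions and the empty biset. -/
def bimap (Φ : Biset A B → Biset C D → Biset E F)
    (hc : ∀ {U U' V V'}, Biset.Isom U U' → Biset.Isom V V' → Biset.Isom (Φ U V) (Φ U' V'))
    (hu : ∀ U V V', Biset.Isom (Φ U (Biset.union V V')) (Biset.union (Φ U V) (Φ U V')))
    (hu' : ∀ U U' V, Biset.Isom (Φ (Biset.union U U') V) (Biset.union (Φ U V) (Φ U' V)))
    (he : ∀ U, Biset.Isom (Φ U (Biset.empty C D)) (Biset.empty E F))
    (he' : ∀ V, Biset.Isom (Φ (Biset.empty A B) V) (Biset.empty E F)) :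
    BisetClass A B →+ BisetClass C D →+ BisetClass E F where
  toFun x :=
    { toFun := Quotient.map₂ Φ (fun _ _ h _ _ h' => hc h h') x
      map_zero' := by
        obtain ⟨U, rfl⟩ := mk_surjective x
        exact mk_eq (he U)
      map_add' := by
        obtain ⟨U, rfl⟩ := mk_surjective x
        rintro ⟨V⟩ ⟨V'⟩
        exact mk_eq (hu U V V') }
  map_zero' := by
    ext ⟨V⟩
    exact mk_eq (he' V)
  map_add' := by
    rintro ⟨U⟩ ⟨U'⟩
    ext ⟨V⟩
    exact mk_eq (hu' U U' V)

end BisetClass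

/-- `RB(H, G) = R ⊗ B(H, G)`, where `B(H, G)` is the Grothendieck group of finite
`(H, G)`-bisets with respect to disjoint union. -/
abbrev RB (R : Type v) [CommRing R] (H G : Type u) [Group H] [Group G] : Type (max (u + 1) v) :=
  R ⊗[ℤ] Algebra.GrothendieckAddGroup (BisetClass H G)

namespace RB

variable {R : Type v} [CommRing R]
variable {A B C D E F : Type u} [Group A] [Group B] [Group C] [Group D] [Group E] [Group F]

/-- The element of `RB(H, G)` of an isomorphism class of bisets. -/
noncomputable def ofClass (R : Type v) [CommRing R] : BisetClass A B →+ RB R A B :=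
  (TensorProduct.mk ℤ R (Algebra.GrothendieckAddGroup (BisetClass A B)) 1).toAddMonoidHom.comp
    Algebra.GrothendieckAddGroup.of

/-- The element of `RB(H, G)` of a biset. -/
noncomputable def of (R : Type v) [CommRing R] (U : Biset A B) : RB R A B :=
  ofClass R (BisetClass.mk U)

/-- The linear extension to `RB(H, G)` of an additive map on isomorphism classes of bisets. -/
noncomputable def lift {X : Type*} [AddCommGroup X] [Module R X] (f : BisetClass A B →+ X) :
    RB R A B →ₗ[R] X :=
  LinearMap.liftBaseChange R (Algebra.GrothendieckAddGroup.lift f).toIntLinearMap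

theorem lift_ofClass {X : Type*} [AddCommGroup X] [Module R X] (f : BisetClass A B →+ X)
    (x : BisetClass A B) : lift f (ofClass R x) = f x := by
  have h : (Algebra.GrothendieckAddGroup.lift f).comp Algebra.GrothendieckAddGroup.of = f :=
    Algebra.GrothendieckAddGroup.lift.symm_apply_apply f
  simpa [lift, ofClass] using DFunLike.congr_fun h x

/-- Linear maps on `RB(H, G)` are determined by their values on bisets. -/
theorem hom_ext {X : Type*} [AddCommGroup X] [Module R X] {f g : RB R A B →ₗ[R] X}
    (h : ∀ U : Biset A B, f (of R U) = g (of R U)) : f = g := by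
  apply TensorProduct.AlgebraTensorModule.curry_injective
  ext x
  have key : Algebra.GrothendieckAddGroup.lift.symm
      (f.toAddMonoidHom.comp (TensorProduct.mk ℤ R
        (Algebra.GrothendieckAddGroup (BisetClass A B)) 1).toAddMonoidHom) =
      Algebra.GrothendieckAddGroup.lift.symm
      (g.toAddMonoidHom.comp (TensorProduct.mk ℤ R
        (Algebra.GrothendieckAddGroup (BisetClass A B)) 1).toAddMonoidHom) := by
    ext y
    obtain ⟨U, rfl⟩ := BisetClass.mk_surjective y
    exact h U
  exact DFunLike.congr_fun (Algebra.GrothendieckAddGroup.lift.symm.injective key) x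

/-- The bilinear extension of a biadditive map on isomorphism classes of bisets. -/
noncomputable def bimap (R : Type v) [CommRing R]
    (φ : BisetClass A B →+ BisetClass C D →+ BisetClass E F) :
    RB R A B →ₗ[R] RB R C D →ₗ[R] RB R E F :=
  lift
    { toFun := fun x => lift ((ofClass R).comp (φ x))
      map_zero' := hom_ext fun U => by simp [of, lift_ofClass]
      map_add' := fun x y => hom_ext fun U => by simp [of, lift_ofClass] }

theorem bimap_ofClass (φ : BisetClass A B →+ BisetClass C D →+ BisetClass E F)
    (x : BisetClass A B) (y : BisetClass C D) :
    bimap R φ (ofClass R x) (ofClass R y) = ofClass R (φ x y) := by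
  simp [bimap, lift_ofClass]

/-- The composition `RB(K, H) × RB(H, G) → RB(K, G)`, the bilinear extension of the composition
of bisets. -/
noncomputable def comp (R : Type v) [CommRing R] (K H G : Type u) [Group K] [Group H] [Group G] :
    RB R K H →ₗ[R] RB R H G →ₗ[R] RB R K G :=
  bimap R (BisetClass.bimap Biset.comp Biset.comp_congr Biset.comp_union Biset.union_comp
    Biset.comp_empty Biset.empty_comp)

/-- The product `RB(H, G) × RB(H', G') → RB(H × H', G × G')`, the bilinear extension of the
product of bisets. -/
noncomputable def prod (R : Type v) [CommRing R] (H G H' G' : Type u) [Group H] [Group G]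
    [Group H'] [Group G'] : RB R H G →ₗ[R] RB R H' G' →ₗ[R] RB R (H × H') (G × G') :=
  bimap R (BisetClass.bimap Biset.prod Biset.prod_congr Biset.prod_union Biset.union_prod
    Biset.prod_empty Biset.empty_prod)

theorem comp_of (V : Biset A B) (U : Biset B C) :
    comp R A B C (of R V) (of R U) = of R (Biset.comp V U) :=
  bimap_ofClass _ _ _

theorem prod_of (U : Biset A B) (V : Biset C D) :
    prod R A B C D (of R U) (of R V) = of R (Biset.prod U V) :=
  bimap_ofClass _ _ _

theorem of_eq {U V : Biset A B} (h : Biset.Isom U V) : of R U = of R V :=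
  congrArg (ofClass R) (BisetClass.mk_eq h)

/-- The elements given by bisets generate `RB(H, G)`. -/
theorem span_of : Submodule.span R (Set.range (of R : Biset A B → RB R A B)) = ⊤ := by
  have h : (Submodule.span R (Set.range (of R : Biset A B → RB R A B))).mkQ = 0 :=
    hom_ext fun U => by
      simpa using Submodule.subset_span (Set.mem_range_self U)
  rw [← Submodule.ker_mkQ (Submodule.span R _), h, LinearMap.ker_zero]

theorem induction {p : RB R A B → Prop} (x : RB R A B) (of : ∀ U, p (of R U)) (zero : p 0)
    (add : ∀ x y, p x → p y → p (x + y)) (smul : ∀ (r : R) x, p x → p (r • x)) : p x := by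
  have hx : x ∈ Submodule.span R (Set.range (RB.of R : Biset A B → RB R A B)) := by
    rw [span_of]
    trivial
  induction hx using Submodule.span_induction with
  | mem x h =>
    obtain ⟨U, rfl⟩ := h
    exact of U
  | zero => exact zero
  | add x y _ _ hx hy => exact add x y hx hy
  | smul r x _ hx => exact smul r x hx

theorem comp_assoc (w : RB R A B) (v : RB R B C) (u : RB R C D) :
    comp R A C D (comp R A B C w v) u = comp R A B D w (comp R B C D v u) := by
  induction w using RB.induction with
  | zero => simp
  | add x y hx hy => simp [hx, hy]
  | smul r x hx => simp [hx]
  | of W =>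
    induction v using RB.induction with
    | zero => simp
    | add x y hx hy => simp [hx, hy]
    | smul r x hx => simp [hx]
    | of V =>
      induction u using RB.induction with
      | zero => simp
      | add x y hx hy => simp [hx, hy]
      | smul r x hx => simp [hx]
      | of U => simpa only [comp_of] using of_eq (Biset.comp_assoc W V U)

theorem id_comp [Finite A] (u : RB R A B) : comp R A A B (of R (Biset.idBiset A)) u = u := by
  induction u using RB.induction with
  | zero => simp
  | add x y hx hy => simp [hx, hy]
  | smul r x hx => simp [hx]
  | of U => simpa only [comp_of] using of_eq (Biset.id_comp U)

theorem comp_id [Finite B] (u : RB R A B) : comp R A B B u (of R (Biset.idBiset B)) = u := by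
  induction u using RB.induction with
  | zero => simp
  | add x y hx hy => simp [hx, hy]
  | smul r x hx => simp [hx]
  | of U => simpa only [comp_of] using of_eq (Biset.comp_id U)

end RB

/-! ### The biset category and biset functors -/

/-- A (non-empty) class of finite groups closed under subquotients and direct products. -/
structure GroupClass : Type (u + 1) where
  Mem : (G : Type u) → [Group G] → Prop
  finite : ∀ {G : Type u} [Group G], Mem G → Finite G
  nonempty : ∃ (G : Type u) (_ : Group G), Mem G
  /-- The image of any morphism from a subgroup of a group in the class is in the class. -/
  subquotient : ∀ {G : Type u} [Group G], Mem G → ∀ (K : Subgroup G) {L : Type u} [Group L]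
    (f : K →* L), Function.Surjective f → Mem L
  prod : ∀ {G H : Type u} [Group G] [Group H], Mem G → Mem H → Mem (G × H)

theorem GroupClass.mem_one (Z : GroupClass.{u}) : Z.Mem PUnit.{u + 1} := by
  obtain ⟨G, _, hG⟩ := Z.nonempty
  exact Z.subquotient hG ⊤ (1 : (⊤ : Subgroup G) →* PUnit.{u + 1}) fun x => ⟨1, rfl⟩

/-- The objects of the biset category over `R` on the class `Z`: the groups in `Z`. -/
structure BisetCat (R : Type v) [CommRing R] (Z : GroupClass.{u}) : Type (u + 1) where
  carrier : Type u
  [group : Group carrier]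
  mem : Z.Mem carrier

namespace BisetCat

variable {R : Type v} [CommRing R] {Z : GroupClass.{u}}

instance : CoeSort (BisetCat R Z) (Type u) := ⟨BisetCat.carrier⟩
instance (G : BisetCat R Z) : Group G := G.group
instance (G : BisetCat R Z) : Finite G := Z.finite G.mem

/-- Morphisms from `G` to `H` are the elements of `RB(H, G)`; the composition is `×_H`, and the
identity of `G` is the `(G, G)`-biset `G`. -/
noncomputable instance : Category (BisetCat R Z) where
  Hom G H := RB R H G
  id G := RB.of R (Biset.idBiset G)
  comp {G H K} φ ψ := RB.comp R K H G ψ φ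
  id_comp φ := RB.comp_id φ
  comp_id φ := RB.id_comp φ
  assoc φ ψ χ := (RB.comp_assoc χ ψ φ).symm

noncomputable instance : Preadditive (BisetCat R Z) where
  homGroup G H := inferInstanceAs (AddCommGroup (RB R H G))
  add_comp G H K φ φ' ψ := (RB.comp R K H G ψ).map_add φ φ'
  comp_add G H K φ ψ ψ' := LinearMap.map_add₂ (RB.comp R K H G) ψ ψ' φ

noncomputable instance : Linear R (BisetCat R Z) where
  homModule G H := inferInstanceAs (Module R (RB R H G))
  smul_comp G H K r φ ψ := (RB.comp R K H G ψ).map_smul r φ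
  comp_smul G H K φ r ψ := LinearMap.map_smul₂ (RB.comp R K H G) r ψ φ

/-- The morphism given by a biset. -/
noncomputable def ofBiset {G H : BisetCat R Z} (U : Biset H G) : G ⟶ H := RB.of R U

/-- The trivial group. -/
def one : BisetCat R Z where
  carrier := PUnit.{u + 1}
  mem := Z.mem_one

/-- The direct product of two groups. -/
def prod (G H : BisetCat R Z) : BisetCat R Z where
  carrier := G × H
  mem := Z.prod G.mem H.mem

/-- The product of two bisets between groups in the class. -/
def prodBiset {G G' H H' : BisetCat R Z} (U : Biset G' G) (V : Biset H' H) :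
    Biset (G'.prod H') (G.prod H) :=
  Biset.prod U V

/-- The product `φ × ψ` of two morphisms. -/
noncomputable def prodHom {G G' H H' : BisetCat R Z} (φ : G ⟶ G') (ψ : H ⟶ H') :
    G.prod H ⟶ G'.prod H' :=
  RB.prod R G' G H' H φ ψ

/-- The morphism `Iso(f)`. -/
noncomputable def isoHom {G H : BisetCat R Z} (f : G ≃* H) : G ⟶ H := ofBiset (Biset.iso f)

/-- The canonical isomorphism `G × (H × K) → (G × H) × K`. -/
def assocEquiv (G H K : BisetCat R Z) : G.prod (H.prod K) ≃* (G.prod H).prod K :=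
  (MulEquiv.prodAssoc (M := G) (N := H) (P := K)).symm

/-- The canonical isomorphism `1 × G → G`. -/
def leftUnitEquiv (G : BisetCat R Z) : one.prod G ≃* G :=
  (MulEquiv.uniqueProd : PUnit.{u + 1} × G ≃* G)

/-- The canonical isomorphism `G × 1 → G`. -/
def rightUnitEquiv (G : BisetCat R Z) : G.prod one ≃* G :=
  (MulEquiv.prodUnique : G × PUnit.{u + 1} ≃* G)

theorem ofBiset_comp {G H K : BisetCat R Z} (U : Biset H G) (V : Biset K H) :
    (ofBiset U : G ⟶ H) ≫ (ofBiset V : H ⟶ K) = ofBiset (Biset.comp V U) :=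
  RB.comp_of V U

theorem prodHom_ofBiset {G G' H H' : BisetCat R Z} (U : Biset G' G) (V : Biset H' H) :
    prodHom (ofBiset U) (ofBiset V) =
      ofBiset (prodBiset U V) :=
  RB.prod_of U V

theorem ofBiset_eq {G H : BisetCat R Z} {U V : Biset H G} (h : Biset.Isom U V) :
    (ofBiset U : G ⟶ H) = ofBiset V := RB.of_eq h

theorem id_eq (G : BisetCat R Z) : 𝟙 G = ofBiset (Biset.idBiset G) := rfl

end BisetCat

/-- A biset functor on `Z` over `R`: an `R`-linear functor from the biset category to
`R`-modules. -/
structure BisetFunctor (R : Type v) [CommRing R] (Z : GroupClass.{u}) where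
  toFunctor : BisetCat R Z ⥤ ModuleCat.{w} R
  additive : toFunctor.Additive
  linear : toFunctor.Linear R

namespace BisetFunctor

variable {R : Type v} [CommRing R] {Z : GroupClass.{u}}

/-- The `R`-module `F(G)`. -/
abbrev obj (F : BisetFunctor.{u, v, w} R Z) (G : BisetCat R Z) : Type w := F.toFunctor.obj G

/-- The `R`-linear map `F(φ) : F(G) → F(H)` of a morphism `φ`. -/
def map (F : BisetFunctor.{u, v, w} R Z) {G H : BisetCat R Z} (φ : G ⟶ H) :
    F.obj G →ₗ[R] F.obj H :=
  (F.toFunctor.map φ).hom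

theorem map_id (F : BisetFunctor.{u, v, w} R Z) {G : BisetCat R Z} (x : F.obj G) :
    F.map (𝟙 G) x = x := by
  simp [map]

theorem map_map (F : BisetFunctor.{u, v, w} R Z) {G H K : BisetCat R Z} (φ : G ⟶ H) (ψ : H ⟶ K)
    (x : F.obj G) : F.map ψ (F.map φ x) = F.map (φ ≫ ψ) x := by
  simp [map]

/-- `H` is a minimal group for `F`: `F(H)` is non-zero, and `F` vanishes on all groups of the
class of order smaller than that of `H`. -/
def IsMinimal (F : BisetFunctor.{u, v, w} R Z) (H : BisetCat R Z) : Prop :=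
  Nontrivial (F.obj H) ∧ ∀ K : BisetCat R Z, Nat.card K < Nat.card H → Subsingleton (F.obj K)

end BisetFunctor

/-! ### Green biset functors and their modules -/

open BisetCat in
/-- A Green biset functor: a biset functor `A` with bilinear products `A(G) × A(H) → A(G × H)` and
an element `ε ∈ A(1)` satisfying associativity, identity and functoriality. -/
structure GreenBisetFunctor (R : Type v) [CommRing R] (Z : GroupClass.{u}) extends
    BisetFunctor.{u, v, w} R Z where
  mul : ∀ {G H : BisetCat R Z}, toBisetFunctor.obj G →ₗ[R] toBisetFunctor.obj H →ₗ[R]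
    toBisetFunctor.obj (G.prod H)
  unit : toBisetFunctor.obj one
  mul_assoc : ∀ {G H K : BisetCat R Z} (a : toBisetFunctor.obj G) (b : toBisetFunctor.obj H)
    (c : toBisetFunctor.obj K),
    mul (mul a b) c = toBisetFunctor.map (isoHom (assocEquiv G H K)) (mul a (mul b c))
  unit_mul : ∀ {G : BisetCat R Z} (a : toBisetFunctor.obj G),
    a = toBisetFunctor.map (isoHom (leftUnitEquiv G)) (mul unit a)
  mul_unit : ∀ {G : BisetCat R Z} (a : toBisetFunctor.obj G),
    a = toBisetFunctor.map (isoHom (rightUnitEquiv G)) (mul a unit)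
  map_mul : ∀ {G G' H H' : BisetCat R Z} (φ : G ⟶ G') (ψ : H ⟶ H') (a : toBisetFunctor.obj G)
    (b : toBisetFunctor.obj H),
    toBisetFunctor.map (prodHom φ ψ) (mul a b) =
      mul (toBisetFunctor.map φ a) (toBisetFunctor.map ψ b)

open BisetCat in
/-- A module over a Green biset functor `A`: a biset functor `M` with bilinear products
`A(G) × M(H) → M(G × H)` satisfying associativity, identity and functoriality. -/
structure GreenModule {R : Type v} [CommRing R] {Z : GroupClass.{u}}
    (A : GreenBisetFunctor.{u, v, w} R Z) extends BisetFunctor.{u, v, w'} R Z where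
  act : ∀ {G H : BisetCat R Z}, A.obj G →ₗ[R] toBisetFunctor.obj H →ₗ[R]
    toBisetFunctor.obj (G.prod H)
  mul_act : ∀ {G H K : BisetCat R Z} (a : A.obj G) (b : A.obj H) (m : toBisetFunctor.obj K),
    act (A.mul a b) m = toBisetFunctor.map (isoHom (assocEquiv G H K)) (act a (act b m))
  unit_act : ∀ {G : BisetCat R Z} (m : toBisetFunctor.obj G),
    m = toBisetFunctor.map (isoHom (leftUnitEquiv G)) (act A.unit m)
  map_act : ∀ {G G' H H' : BisetCat R Z} (φ : G ⟶ G') (ψ : H ⟶ H') (a : A.obj G)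
    (m : toBisetFunctor.obj H),
    toBisetFunctor.map (prodHom φ ψ) (act a m) =
      act (A.map φ a) (toBisetFunctor.map ψ m)

/-- A submodule of an `A`-module `M`: submodules `N(G) ≤ M(G)` stable under the maps `M(φ)` and
under the products with elements of `A`. -/
structure GreenSubmodule {R : Type v} [CommRing R] {Z : GroupClass.{u}}
    {A : GreenBisetFunctor.{u, v, w} R Z} (M : GreenModule.{u, v, w, w'} A) where
  obj : ∀ G : BisetCat R Z, Submodule R (M.obj G)
  map_mem : ∀ {G H : BisetCat R Z} (φ : G ⟶ H) {m : M.obj G}, m ∈ obj G → M.map φ m ∈ obj H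
  act_mem : ∀ {G H : BisetCat R Z} (a : A.obj G) {m : M.obj H}, m ∈ obj H →
    M.act a m ∈ obj (G.prod H)

/-- An `A`-module is simple if it is non-zero and its only submodules are zero and itself. -/
def GreenModule.IsSimple {R : Type v} [CommRing R] {Z : GroupClass.{u}}
    {A : GreenBisetFunctor.{u, v, w} R Z} (M : GreenModule.{u, v, w, w'} A) : Prop :=
  (∃ G, Nontrivial (M.obj G)) ∧
    ∀ N : GreenSubmodule M, (∀ G, N.obj G = ⊥) ∨ (∀ G, N.obj G = ⊤)

/-! ### Composition of elements of a Green biset functor -/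

namespace Biset

section Contraction

variable (H G K L : Type u) [Group H] [Group G] [Group K] [Group L]
variable [Finite H] [Finite G] [Finite K] [Finite L]

/-- The `(G × G, 1)`-biset `G` with `(g, g') · x = g x g'⁻¹`. -/
def diag : Biset (G × G) PUnit.{u + 1} :=
  ofFun G (fun g x => g.1 * x * g.2⁻¹) (fun x _ => x) (fun x => by simp)
    (fun a b x => by simp [mul_assoc]) (fun x => rfl) (fun x _ _ => rfl) (fun a x _ => rfl)

/-- For the `(1, G × G)`-biset `G` with `x · (g, g') = g⁻¹ x g'` (the opposite of `diag G`), its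
product on the left with the `(H, H)`-biset `H` and on the right with the `(K, K)`-biset `K`, seen
as an `(H × K, (H × G) × (G × K))`-biset. -/
def contract : Biset (H × K) ((H × G) × (G × K)) :=
  ofFun (H × G × K) (fun a x => (a.1 * x.1, x.2.1, a.2 * x.2.2))
    (fun x b => (x.1 * b.1.1, b.1.2⁻¹ * x.2.1 * b.2.1, x.2.2 * b.2.2))
    (fun x => by simp) (fun a b x => by simp [mul_assoc]) (fun x => by simp)
    (fun x a b => by simp [mul_assoc]) (fun a x b => by simp [mul_assoc])

/-- The product of the `(H, H)`-biset `H` and the `(1, G × G)`-biset `G`, seen as an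
`(H, (H × G) × G)`-biset. -/
def contractRight : Biset H ((H × G) × G) :=
  ofFun (H × G) (fun a x => (a * x.1, x.2)) (fun x b => (x.1 * b.1.1, b.1.2⁻¹ * x.2 * b.2))
    (fun x => by simp) (fun a b x => by simp [mul_assoc]) (fun x => by simp)
    (fun x a b => by simp [mul_assoc]) (fun a x b => by simp [mul_assoc])

/-- An auxiliary biset with two contractions. -/
def contract₂ : Biset (L × K) ((L × H) × ((H × G) × (G × K))) :=
  ofFun (L × H × G × K) (fun a x => (a.1 * x.1, x.2.1, x.2.2.1, a.2 * x.2.2.2))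
    (fun x b => (x.1 * b.1.1, b.1.2⁻¹ * x.2.1 * b.2.1.1, b.2.1.2⁻¹ * x.2.2.1 * b.2.2.1,
      x.2.2.2 * b.2.2.2))
    (fun x => by simp) (fun a b x => by simp [mul_assoc]) (fun x => by simp)
    (fun x a b => by simp [mul_assoc]) (fun a x b => by simp [mul_assoc])

/-- An auxiliary biset with two contractions. -/
def contractRight₂ : Biset L ((L × H) × ((H × G) × G)) :=
  ofFun (L × H × G) (fun a x => (a * x.1, x.2.1, x.2.2))
    (fun x b => (x.1 * b.1.1, b.1.2⁻¹ * x.2.1 * b.2.1.1, b.2.1.2⁻¹ * x.2.2 * b.2.2))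
    (fun x => by simp) (fun a b x => by simp [mul_assoc]) (fun x => by simp)
    (fun x a b => by simp [mul_assoc]) (fun a x b => by simp [mul_assoc])

variable {H G K L}

theorem comp_iso {A B C : Type u} [Group A] [Group B] [Group C] [Finite B] (U : Biset A B)
    (V : Biset A C) (f : C ≃* B) (e : U ≃ V) (hl : ∀ (a : A) (x : U), e (a • x) = a • e x)
    (hr : ∀ (c : C) (x : U), e (x <• f c) = e x <• c) : Isom (comp U (iso f)) V := by
  have hr' : ∀ (b : B) (x : U), e (x <• b) = e x <• f.symm b := fun b x => by
    rw [← hr, MulEquiv.apply_symm_apply]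
  refine comp_isom (fun x (b : B) => e (x <• b)) ?_ ?_ ?_ ?_ ?_
  · intro x b (b' : B)
    exact congrArg e (mul_smul (MulOpposite.op b') (MulOpposite.op b) x).symm
  · intro a x (b : B)
    show e _ = _
    rw [← hl]
    exact congrArg e (smul_comm a (MulOpposite.op b) x).symm
  · intro c x (b : B)
    show e (x <• (b * f c)) = _
    rw [← hr]
    exact congrArg e (mul_smul (MulOpposite.op (f c)) (MulOpposite.op b) x)
  · intro w
    exact ⟨e.symm w, (1 : B), by show e (_ <• (1 : B)) = w; simp⟩
  · intro x (b : B) x' (b' : B) h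
    have h' : x <• b = x' <• b' := e.injective h
    refine ⟨b * b'⁻¹, ?_, (inv_mul_cancel_right b b').symm⟩
    simp only [MulOpposite.op_mul, mul_smul, h']
    simp

/-- Recognition of a composition of bisets whose actions are given by explicit functions. -/
theorem comp_isom' {A B C : Type u} [Group A] [Group B] [Group C] {V : Biset A B} {U : Biset B C}
    {W : Biset A C} {lV : A → V → V} {rV : V → B → V} {lU : B → U → U} {rU : U → C → U}
    {lW : A → W → W} {rW : W → C → W}
    (hlV : ∀ a x, lV a x = a • x) (hrV : ∀ x b, rV x b = x <• b)
    (hlU : ∀ a x, lU a x = a • x) (hrU : ∀ x b, rU x b = x <• b)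
    (hlW : ∀ a x, lW a x = a • x) (hrW : ∀ x b, rW x b = x <• b)
    (f : V → U → W)
    (hf : ∀ v b u, f (rV v b) u = f v (lU b u))
    (hl : ∀ a v u, f (lV a v) u = lW a (f v u))
    (hr : ∀ c v u, f v (rU u c) = rW (f v u) c)
    (hs : ∀ w, ∃ v u, f v u = w)
    (hi : ∀ v u v' u', f v u = f v' u' → ∃ b : B, v' = rV v b ∧ u = lU b u') :
    Isom (comp V U) W := by
  simp only [hlV, hrV, hlU, hrU, hlW, hrW] at hf hl hr hi
  exact comp_isom f hf hl hr hs hi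

theorem contract_assoc_right :
    Isom (comp (contract L H K) (prod (idBiset (L × H)) (contract H G K)))
      (contract₂ H G K L) := by
  refine comp_isom' (V := contract L H K) (U := prod (idBiset (L × H)) (contract H G K))
    (W := contract₂ H G K L)
    (lV := fun a (x : L × H × K) => ((a.1 * x.1, x.2.1, a.2 * x.2.2) : L × H × K))
    (rV := fun (x : L × H × K) b => ((x.1 * b.1.1, b.1.2⁻¹ * x.2.1 * b.2.1, x.2.2 * b.2.2) : L × H × K))
    (lU := fun b (y : (L × H) × (H × G × K)) => ((b.1 * y.1, (b.2.1 * y.2.1, y.2.2.1, b.2.2 * y.2.2.2)) : (L × H) × (H × G × K)))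
    (rU := fun (y : (L × H) × (H × G × K)) c => ((y.1 * c.1, (y.2.1 * c.2.1.1, c.2.1.2⁻¹ * y.2.2.1 * c.2.2.1, y.2.2.2 * c.2.2.2)) : (L × H) × (H × G × K)))
    (lW := fun a (x : L × H × G × K) => ((a.1 * x.1, x.2.1, x.2.2.1, a.2 * x.2.2.2) : L × H × G × K))
    (rW := fun (x : L × H × G × K) b => ((x.1 * b.1.1, b.1.2⁻¹ * x.2.1 * b.2.1.1, b.2.1.2⁻¹ * x.2.2.1 * b.2.2.1, x.2.2.2 * b.2.2.2) : L × H × G × K))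
    (fun _ _ => rfl) (fun _ _ => rfl) (fun _ _ => rfl) (fun _ _ => rfl) (fun _ _ => rfl)
    (fun _ _ => rfl)
    (fun (x : L × H × K) (y : (L × H) × (H × G × K)) => ((x.1 * y.1.1, y.1.2⁻¹ * x.2.1 * y.2.1, y.2.2.1, x.2.2 * y.2.2.2) : L × H × G × K))
    ?_ ?_ ?_ ?_ ?_
  · intro (x : L × H × K) b (y : (L × H) × (H × G × K))
    simp [mul_assoc]
    rfl
  · intro a (x : L × H × K) (y : (L × H) × (H × G × K))
    simp [mul_assoc]
    rfl
  · intro c (x : L × H × K) (y : (L × H) × (H × G × K))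
    simp [mul_assoc]
    rfl
  · intro (w : L × H × G × K)
    exact ⟨((1, w.2.1, 1) : L × H × K),
      (((w.1, 1), (1, w.2.2.1, w.2.2.2)) : (L × H) × (H × G × K)), by simp; rfl⟩
  · rintro ⟨x, y, z⟩ ⟨⟨l, h⟩, h', g, k⟩ ⟨x', y', z'⟩ ⟨⟨m, n⟩, n', g', k'⟩ e
    obtain ⟨e1, e'⟩ := Prod.ext_iff.1 e
    obtain ⟨e2, e'⟩ := Prod.ext_iff.1 e'
    obtain ⟨e3, e4⟩ := Prod.ext_iff.1 e'
    dsimp only at e1 e2 e3 e4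
    refine ⟨((x⁻¹ * x', h * n⁻¹), (h' * n'⁻¹, z⁻¹ * z')),
      Prod.ext (mul_inv_cancel_left x x').symm (Prod.ext ?_ (mul_inv_cancel_left z z').symm),
      Prod.ext (Prod.ext ?_ (inv_mul_cancel_right h n).symm)
        (Prod.ext (inv_mul_cancel_right h' n').symm (Prod.ext e3 ?_))⟩
    · change y' = (h * n⁻¹)⁻¹ * y * (h' * n'⁻¹)
      rw [show y' = n * (n⁻¹ * y' * n') * n'⁻¹ by group, ← e2]
      group
    · change l = x⁻¹ * x' * m
      rw [mul_assoc, ← e1, inv_mul_cancel_left]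
    · change k = z⁻¹ * z' * k'
      rw [mul_assoc, ← e4, inv_mul_cancel_left]

/-- An auxiliary biset with two contractions, bracketed to the left. -/
def contract₂' (H G K L : Type u) [Group H] [Group G] [Group K] [Group L]
    [Finite H] [Finite G] [Finite K] [Finite L] :
    Biset (L × K) (((L × H) × (H × G)) × (G × K)) :=
  ofFun (L × H × G × K) (fun a x => (a.1 * x.1, x.2.1, x.2.2.1, a.2 * x.2.2.2))
    (fun x b => (x.1 * b.1.1.1, b.1.1.2⁻¹ * x.2.1 * b.1.2.1, b.1.2.2⁻¹ * x.2.2.1 * b.2.1,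
      x.2.2.2 * b.2.2))
    (fun x => by simp) (fun a b x => by simp [mul_assoc]) (fun x => by simp)
    (fun x a b => by simp [mul_assoc]) (fun a x b => by simp [mul_assoc])

/-- An auxiliary biset with two contractions, bracketed to the left. -/
def contractRight₂' (H G L : Type u) [Group H] [Group G] [Group L]
    [Finite H] [Finite G] [Finite L] :
    Biset L (((L × H) × (H × G)) × G) :=
  ofFun (L × H × G) (fun a x => (a * x.1, x.2.1, x.2.2))
    (fun x b => (x.1 * b.1.1.1, b.1.1.2⁻¹ * x.2.1 * b.1.2.1, b.1.2.2⁻¹ * x.2.2 * b.2))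
    (fun x => by simp) (fun a b x => by simp [mul_assoc]) (fun x => by simp)
    (fun x a b => by simp [mul_assoc]) (fun a x b => by simp [mul_assoc])

theorem contract_assoc_left :
    Isom (comp (contract L G K) (prod (contract L H G) (idBiset (G × K))))
      (contract₂' H G K L) := by
  refine comp_isom' (V := contract L G K) (U := prod (contract L H G) (idBiset (G × K)))
    (W := contract₂' H G K L)
    (lV := fun a (x : L × G × K) => ((a.1 * x.1, x.2.1, a.2 * x.2.2) : L × G × K))
    (rV := fun (x : L × G × K) b => ((x.1 * b.1.1, b.1.2⁻¹ * x.2.1 * b.2.1, x.2.2 * b.2.2) : L × G × K))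
    (lU := fun b (y : (L × H × G) × (G × K)) => (((b.1.1 * y.1.1, y.1.2.1, b.1.2 * y.1.2.2), b.2 * y.2) : (L × H × G) × (G × K)))
    (rU := fun (y : (L × H × G) × (G × K)) c => (((y.1.1 * c.1.1.1, c.1.1.2⁻¹ * y.1.2.1 * c.1.2.1, y.1.2.2 * c.1.2.2), y.2 * c.2) : (L × H × G) × (G × K)))
    (lW := fun a (x : L × H × G × K) => ((a.1 * x.1, x.2.1, x.2.2.1, a.2 * x.2.2.2) : L × H × G × K))
    (rW := fun (x : L × H × G × K) b => ((x.1 * b.1.1.1, b.1.1.2⁻¹ * x.2.1 * b.1.2.1, b.1.2.2⁻¹ * x.2.2.1 * b.2.1, x.2.2.2 * b.2.2) : L × H × G × K))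
    (fun _ _ => rfl) (fun _ _ => rfl) (fun _ _ => rfl) (fun _ _ => rfl) (fun _ _ => rfl)
    (fun _ _ => rfl)
    (fun (x : L × G × K) (y : (L × H × G) × (G × K)) => ((x.1 * y.1.1, y.1.2.1, y.1.2.2⁻¹ * x.2.1 * y.2.1, x.2.2 * y.2.2) : L × H × G × K))
    ?_ ?_ ?_ ?_ ?_
  · intro (x : L × G × K) b (y : (L × H × G) × (G × K))
    simp [mul_assoc]
    rfl
  · intro a (x : L × G × K) (y : (L × H × G) × (G × K))
    simp [mul_assoc]
    rfl
  · intro c (x : L × G × K) (y : (L × H × G) × (G × K))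
    simp [mul_assoc]
    rfl
  · intro (w : L × H × G × K)
    exact ⟨((1, w.2.2.1, 1) : L × G × K),
      (((w.1, w.2.1, 1), (1, w.2.2.2)) : (L × H × G) × (G × K)), by simp; rfl⟩
  · rintro ⟨x, y, z⟩ ⟨⟨l, h, g⟩, g₁, k⟩ ⟨x', y', z'⟩ ⟨⟨l', h', g'⟩, g₁', k'⟩ e
    obtain ⟨e1, e'⟩ := Prod.ext_iff.1 e
    obtain ⟨e2, e'⟩ := Prod.ext_iff.1 e'
    obtain ⟨e3, e4⟩ := Prod.ext_iff.1 e'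
    dsimp only at e1 e2 e3 e4
    refine ⟨((x⁻¹ * x', g * g'⁻¹), (g₁ * g₁'⁻¹, z⁻¹ * z')),
      Prod.ext (mul_inv_cancel_left x x').symm (Prod.ext ?_ (mul_inv_cancel_left z z').symm),
      Prod.ext (Prod.ext ?_ (Prod.ext e2 (inv_mul_cancel_right g g').symm))
        (Prod.ext (inv_mul_cancel_right g₁ g₁').symm ?_)⟩
    · change y' = (g * g'⁻¹)⁻¹ * y * (g₁ * g₁'⁻¹)
      rw [show y' = g' * (g'⁻¹ * y' * g₁') * g₁'⁻¹ by group, ← e3]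
      group
    · change l = x⁻¹ * x' * l'
      rw [mul_assoc, ← e1, inv_mul_cancel_left]
    · change k = z⁻¹ * z' * k'
      rw [mul_assoc, ← e4, inv_mul_cancel_left]

theorem contractRight_assoc_right :
    Isom (comp (contractRight L H) (prod (idBiset (L × H)) (contractRight H G)))
      (contractRight₂ H G L) := by
  refine comp_isom' (V := contractRight L H) (U := prod (idBiset (L × H)) (contractRight H G))
    (W := contractRight₂ H G L)
    (lV := fun a (x : L × H) => ((a * x.1, x.2) : L × H))
    (rV := fun (x : L × H) b => ((x.1 * b.1.1, b.1.2⁻¹ * x.2 * b.2) : L × H))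
    (lU := fun b (y : (L × H) × (H × G)) => ((b.1 * y.1, (b.2 * y.2.1, y.2.2)) : (L × H) × (H × G)))
    (rU := fun (y : (L × H) × (H × G)) c => ((y.1 * c.1, (y.2.1 * c.2.1.1, c.2.1.2⁻¹ * y.2.2 * c.2.2)) : (L × H) × (H × G)))
    (lW := fun a (x : L × H × G) => ((a * x.1, x.2.1, x.2.2) : L × H × G))
    (rW := fun (x : L × H × G) b => ((x.1 * b.1.1, b.1.2⁻¹ * x.2.1 * b.2.1.1, b.2.1.2⁻¹ * x.2.2 * b.2.2) : L × H × G))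
    (fun _ _ => rfl) (fun _ _ => rfl) (fun _ _ => rfl) (fun _ _ => rfl) (fun _ _ => rfl)
    (fun _ _ => rfl)
    (fun (x : L × H) (y : (L × H) × (H × G)) => ((x.1 * y.1.1, y.1.2⁻¹ * x.2 * y.2.1, y.2.2) : L × H × G))
    ?_ ?_ ?_ ?_ ?_
  · intro (x : L × H) b (y : (L × H) × (H × G))
    simp [mul_assoc]
    rfl
  · intro a (x : L × H) (y : (L × H) × (H × G))
    simp [mul_assoc]
    rfl
  · intro c (x : L × H) (y : (L × H) × (H × G))
    simp [mul_assoc]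
    rfl
  · intro (w : L × H × G)
    exact ⟨((1, w.2.1) : L × H),
      (((w.1, 1), (1, w.2.2)) : (L × H) × (H × G)), by simp; rfl⟩
  · rintro ⟨x, y⟩ ⟨⟨l, h⟩, h', g⟩ ⟨x', y'⟩ ⟨⟨m, n⟩, n', g'⟩ e
    obtain ⟨e1, e'⟩ := Prod.ext_iff.1 e
    obtain ⟨e2, e3⟩ := Prod.ext_iff.1 e'
    dsimp only at e1 e2 e3
    refine ⟨((x⁻¹ * x', h * n⁻¹), h' * n'⁻¹),
      Prod.ext (mul_inv_cancel_left x x').symm ?_,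
      Prod.ext (Prod.ext ?_ (inv_mul_cancel_right h n).symm)
        (Prod.ext (inv_mul_cancel_right h' n').symm e3)⟩
    · change y' = (h * n⁻¹)⁻¹ * y * (h' * n'⁻¹)
      rw [show y' = n * (n⁻¹ * y' * n') * n'⁻¹ by group, ← e2]
      group
    · change l = x⁻¹ * x' * m
      rw [mul_assoc, ← e1, inv_mul_cancel_left]

theorem contractRight_assoc_left :
    Isom (comp (contractRight L G) (prod (contract L H G) (idBiset G)))
      (contractRight₂' H G L) := by
  refine comp_isom' (V := contractRight L G) (U := prod (contract L H G) (idBiset G))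
    (W := contractRight₂' H G L)
    (lV := fun a (x : L × G) => ((a * x.1, x.2) : L × G))
    (rV := fun (x : L × G) b => ((x.1 * b.1.1, b.1.2⁻¹ * x.2 * b.2) : L × G))
    (lU := fun b (y : (L × H × G) × G) => (((b.1.1 * y.1.1, y.1.2.1, b.1.2 * y.1.2.2), b.2 * y.2) : (L × H × G) × G))
    (rU := fun (y : (L × H × G) × G) c => (((y.1.1 * c.1.1.1, c.1.1.2⁻¹ * y.1.2.1 * c.1.2.1, y.1.2.2 * c.1.2.2), y.2 * c.2) : (L × H × G) × G))
    (lW := fun a (x : L × H × G) => ((a * x.1, x.2.1, x.2.2) : L × H × G))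
    (rW := fun (x : L × H × G) b => ((x.1 * b.1.1.1, b.1.1.2⁻¹ * x.2.1 * b.1.2.1, b.1.2.2⁻¹ * x.2.2 * b.2) : L × H × G))
    (fun _ _ => rfl) (fun _ _ => rfl) (fun _ _ => rfl) (fun _ _ => rfl) (fun _ _ => rfl)
    (fun _ _ => rfl)
    (fun (x : L × G) (y : (L × H × G) × G) => ((x.1 * y.1.1, y.1.2.1, y.1.2.2⁻¹ * x.2 * y.2) : L × H × G))
    ?_ ?_ ?_ ?_ ?_
  · intro (x : L × G) b (y : (L × H × G) × G)
    simp [mul_assoc]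
    rfl
  · intro a (x : L × G) (y : (L × H × G) × G)
    simp [mul_assoc]
    rfl
  · intro c (x : L × G) (y : (L × H × G) × G)
    simp [mul_assoc]
    rfl
  · intro (w : L × H × G)
    exact ⟨((1, w.2.2) : L × G),
      (((w.1, w.2.1, 1), 1) : (L × H × G) × G), by simp; rfl⟩
  · rintro (⟨x, y⟩ : L × G) (⟨⟨l, h, g⟩, g₁⟩ : (L × H × G) × G) (⟨x', y'⟩ : L × G)
      (⟨⟨l', h', g'⟩, g₁'⟩ : (L × H × G) × G) e
    obtain ⟨e1, e'⟩ := Prod.ext_iff.1 e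
    obtain ⟨e2, e3⟩ := Prod.ext_iff.1 e'
    dsimp only at e1 e2 e3
    refine ⟨((x⁻¹ * x', g * g'⁻¹), g₁ * g₁'⁻¹),
      Prod.ext (mul_inv_cancel_left x x').symm ?_,
      Prod.ext (Prod.ext ?_ (Prod.ext e2 (inv_mul_cancel_right g g').symm))
        (inv_mul_cancel_right g₁ g₁').symm⟩
    · change y' = (g * g'⁻¹)⁻¹ * y * (g₁ * g₁'⁻¹)
      rw [show y' = g' * (g'⁻¹ * y' * g₁') * g₁'⁻¹ by group, ← e3]
      group
    · change l = x⁻¹ * x' * l'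
      rw [mul_assoc, ← e1, inv_mul_cancel_left]

theorem contract_diag_left :
    Isom (comp (contract G G K) (prod (diag G) (idBiset (G × K))))
      (iso (MulEquiv.uniqueProd : PUnit.{u + 1} × (G × K) ≃* G × K)) := by
  refine comp_isom' (V := contract G G K) (U := prod (diag G) (idBiset (G × K)))
    (W := iso (MulEquiv.uniqueProd : PUnit.{u + 1} × (G × K) ≃* G × K))
    (lV := fun a (x : G × G × K) => ((a.1 * x.1, x.2.1, a.2 * x.2.2) : G × G × K))
    (rV := fun (x : G × G × K) b => ((x.1 * b.1.1, b.1.2⁻¹ * x.2.1 * b.2.1, x.2.2 * b.2.2) : G × G × K))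
    (lU := fun b (y : G × (G × K)) => ((b.1.1 * y.1 * b.1.2⁻¹, (b.2.1 * y.2.1, b.2.2 * y.2.2)) : G × (G × K)))
    (rU := fun (y : G × (G × K)) c => ((y.1, (y.2.1 * c.2.1, y.2.2 * c.2.2)) : G × (G × K)))
    (lW := fun a (x : G × K) => ((a.1 * x.1, a.2 * x.2) : G × K))
    (rW := fun (x : G × K) b => ((x.1 * b.2.1, x.2 * b.2.2) : G × K))
    (fun _ _ => rfl) (fun _ _ => rfl) (fun _ _ => rfl) (fun _ _ => rfl) (fun _ _ => rfl)
    (fun _ _ => rfl)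
    (fun (x : G × G × K) (y : G × (G × K)) => ((x.1 * y.1 * x.2.1 * y.2.1, x.2.2 * y.2.2) : G × K))
    ?_ ?_ ?_ ?_ ?_
  · intro (x : G × G × K) b (y : G × (G × K))
    simp [mul_assoc]
    rfl
  · intro a (x : G × G × K) (y : G × (G × K))
    simp [mul_assoc]
    rfl
  · intro c (x : G × G × K) (y : G × (G × K))
    simp [mul_assoc]
    rfl
  · intro (w : G × K)
    exact ⟨((1, 1, 1) : G × G × K), ((1, w) : G × (G × K)), by simp; rfl⟩
  · rintro (⟨x, y, z⟩ : G × G × K) (⟨t, g, k⟩ : G × G × K) (⟨x', y', z'⟩ : G × G × K)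
      (⟨t', g', k'⟩ : G × G × K) e
    obtain ⟨e1, e2⟩ := Prod.ext_iff.1 e
    dsimp only at e1 e2
    refine ⟨((x⁻¹ * x', y * g * g'⁻¹ * y'⁻¹), (g * g'⁻¹, z⁻¹ * z')),
      Prod.ext (mul_inv_cancel_left x x').symm (Prod.ext ?_ (mul_inv_cancel_left z z').symm),
      Prod.ext ?_ (Prod.ext (inv_mul_cancel_right g g').symm ?_)⟩
    · change y' = (y * g * g'⁻¹ * y'⁻¹)⁻¹ * y * (g * g'⁻¹)
      group
    · change t = x⁻¹ * x' * t' * (y * g * g'⁻¹ * y'⁻¹)⁻¹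
      rw [show x⁻¹ * x' * t' * (y * g * g'⁻¹ * y'⁻¹)⁻¹ = x⁻¹ * (x' * t' * y' * g') * g⁻¹ * y⁻¹ by
        group, ← e1]
      group
    · change k = z⁻¹ * z' * k'
      rw [mul_assoc, ← e2, inv_mul_cancel_left]

theorem contract_diag_right :
    Isom (comp (contract H G G) (prod (idBiset (H × G)) (diag G)))
      (iso (MulEquiv.prodUnique : (H × G) × PUnit.{u + 1} ≃* H × G)) := by
  refine comp_isom' (V := contract H G G) (U := prod (idBiset (H × G)) (diag G))
    (W := iso (MulEquiv.prodUnique : (H × G) × PUnit.{u + 1} ≃* H × G))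
    (lV := fun a (x : H × G × G) => ((a.1 * x.1, x.2.1, a.2 * x.2.2) : H × G × G))
    (rV := fun (x : H × G × G) b => ((x.1 * b.1.1, b.1.2⁻¹ * x.2.1 * b.2.1, x.2.2 * b.2.2) : H × G × G))
    (lU := fun b (y : (H × G) × G) => (((b.1.1 * y.1.1, b.1.2 * y.1.2), b.2.1 * y.2 * b.2.2⁻¹) : (H × G) × G))
    (rU := fun (y : (H × G) × G) c => (((y.1.1 * c.1.1, y.1.2 * c.1.2), y.2) : (H × G) × G))
    (lW := fun a (x : H × G) => ((a.1 * x.1, a.2 * x.2) : H × G))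
    (rW := fun (x : H × G) b => ((x.1 * b.1.1, x.2 * b.1.2) : H × G))
    (fun _ _ => rfl) (fun _ _ => rfl) (fun _ _ => rfl) (fun _ _ => rfl) (fun _ _ => rfl)
    (fun _ _ => rfl)
    (fun (x : H × G × G) (y : (H × G) × G) => ((x.1 * y.1.1, x.2.2 * y.2⁻¹ * x.2.1⁻¹ * y.1.2) : H × G))
    ?_ ?_ ?_ ?_ ?_
  · intro (x : H × G × G) b (y : (H × G) × G)
    simp [mul_assoc]
    rfl
  · intro a (x : H × G × G) (y : (H × G) × G)
    simp [mul_assoc]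
    rfl
  · intro c (x : H × G × G) (y : (H × G) × G)
    simp [mul_assoc]
    rfl
  · intro (w : H × G)
    exact ⟨((1, 1, 1) : H × G × G), ((w, 1) : (H × G) × G), by simp; rfl⟩
  · rintro (⟨x, y, z⟩ : H × G × G) (⟨⟨h, g⟩, t⟩ : (H × G) × G) (⟨x', y', z'⟩ : H × G × G)
      (⟨⟨h', g'⟩, t'⟩ : (H × G) × G) e
    obtain ⟨e1, e2⟩ := Prod.ext_iff.1 e
    dsimp only at e1 e2
    refine ⟨((x⁻¹ * x', g * g'⁻¹), (y⁻¹ * g * g'⁻¹ * y', z⁻¹ * z')),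
      Prod.ext (mul_inv_cancel_left x x').symm (Prod.ext ?_ (mul_inv_cancel_left z z').symm),
      Prod.ext (Prod.ext ?_ (inv_mul_cancel_right g g').symm) ?_⟩
    · change y' = (g * g'⁻¹)⁻¹ * y * (y⁻¹ * g * g'⁻¹ * y')
      group
    · change h = x⁻¹ * x' * h'
      rw [mul_assoc, ← e1, inv_mul_cancel_left]
    · change t = y⁻¹ * g * g'⁻¹ * y' * t' * (z⁻¹ * z')⁻¹
      rw [show y⁻¹ * g * g'⁻¹ * y' * t' * (z⁻¹ * z')⁻¹ =
        y⁻¹ * g * (z' * t'⁻¹ * y'⁻¹ * g')⁻¹ * z by group, ← e2]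
      group

theorem contractRight_diag_left :
    Isom (comp (contractRight G G) (prod (diag G) (idBiset G)))
      (iso (MulEquiv.uniqueProd : PUnit.{u + 1} × G ≃* G)) := by
  refine comp_isom' (V := contractRight G G) (U := prod (diag G) (idBiset G))
    (W := iso (MulEquiv.uniqueProd : PUnit.{u + 1} × G ≃* G))
    (lV := fun a (x : G × G) => ((a * x.1, x.2) : G × G))
    (rV := fun (x : G × G) b => ((x.1 * b.1.1, b.1.2⁻¹ * x.2 * b.2) : G × G))
    (lU := fun b (y : G × G) => ((b.1.1 * y.1 * b.1.2⁻¹, b.2 * y.2) : G × G))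
    (rU := fun (y : G × G) c => ((y.1, y.2 * c.2) : G × G))
    (lW := fun a (x : G) => (a * x : G))
    (rW := fun (x : G) b => (x * b.2 : G))
    (fun _ _ => rfl) (fun _ _ => rfl) (fun _ _ => rfl) (fun _ _ => rfl) (fun _ _ => rfl)
    (fun _ _ => rfl)
    (fun (x : G × G) (y : G × G) => (x.1 * y.1 * x.2 * y.2 : G))
    ?_ ?_ ?_ ?_ ?_
  · intro (x : G × G) b (y : G × G)
    simp [mul_assoc]
    rfl
  · intro a (x : G × G) (y : G × G)
    simp [mul_assoc]
    rfl
  · intro c (x : G × G) (y : G × G)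
    simp [mul_assoc]
    rfl
  · intro (w : G)
    exact ⟨((1, 1) : G × G), ((1, w) : G × G), by simp; rfl⟩
  · rintro (⟨x, y⟩ : G × G) (⟨t, g⟩ : G × G) (⟨x', y'⟩ : G × G) (⟨t', g'⟩ : G × G) e
    replace e : x * t * y * g = x' * t' * y' * g' := e
    refine ⟨((x⁻¹ * x', y * g * g'⁻¹ * y'⁻¹), g * g'⁻¹),
      Prod.ext (mul_inv_cancel_left x x').symm ?_,
      Prod.ext ?_ (inv_mul_cancel_right g g').symm⟩
    · change y' = (y * g * g'⁻¹ * y'⁻¹)⁻¹ * y * (g * g'⁻¹)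
      group
    · change t = x⁻¹ * x' * t' * (y * g * g'⁻¹ * y'⁻¹)⁻¹
      rw [show x⁻¹ * x' * t' * (y * g * g'⁻¹ * y'⁻¹)⁻¹ = x⁻¹ * (x' * t' * y' * g') * g⁻¹ * y⁻¹ by
        group]
      rw [← e]
      group


theorem contract_assoc :
    Isom (comp (comp (contract L G K) (prod (contract L H G) (idBiset (G × K))))
        (iso (MulEquiv.prodAssoc : ((L × H) × (H × G)) × (G × K) ≃* _).symm))
      (comp (contract L H K) (prod (idBiset (L × H)) (contract H G K))) :=
  ((comp_congr contract_assoc_left (Isom.refl _)).trans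
    (comp_iso (contract₂' H G K L) (contract₂ H G K L) _ (Equiv.refl (L × H × G × K))
      (fun _ _ => rfl) (fun _ _ => rfl))).trans contract_assoc_right.symm

theorem contractRight_assoc :
    Isom (comp (comp (contractRight L G) (prod (contract L H G) (idBiset G)))
        (iso (MulEquiv.prodAssoc : ((L × H) × (H × G)) × G ≃* _).symm))
      (comp (contractRight L H) (prod (idBiset (L × H)) (contractRight H G))) :=
  ((comp_congr contractRight_assoc_left (Isom.refl _)).trans
    (comp_iso (contractRight₂' H G L) (contractRight₂ H G L) _ (Equiv.refl (L × H × G))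
      (fun _ _ => rfl) (fun _ _ => rfl))).trans contractRight_assoc_right.symm

end Contraction

end Biset

namespace GreenBisetFunctor

open BisetCat

variable {R : Type v} [CommRing R] {Z : GroupClass.{u}} (A : GreenBisetFunctor.{u, v, w} R Z)

/-- The biset `contract` of groups in the class. -/
def contractBiset (H G K : BisetCat R Z) : Biset (H.prod K) ((H.prod G).prod (G.prod K)) :=
  Biset.contract H G K

/-- The biset `contractRight` of groups in the class. -/
def contractRightBiset (H G : BisetCat R Z) : Biset H ((H.prod G).prod G) :=
  Biset.contractRight H G

/-- The biset `diag` of a group in the class. -/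
def diagBiset (G : BisetCat R Z) : Biset (G.prod G) (one : BisetCat R Z) := Biset.diag G

/-- The contraction `(H × G) × (G × K) → H × K` in the biset category. -/
noncomputable def contractHom (H G K : BisetCat R Z) :
    (H.prod G).prod (G.prod K) ⟶ H.prod K :=
  ofBiset (contractBiset H G K)

/-- The contraction `(H × G) × G → H` in the biset category. -/
noncomputable def contractRightHom (H G : BisetCat R Z) : (H.prod G).prod G ⟶ H :=
  ofBiset (contractRightBiset H G)

/-- The morphism `1 → G × G` given by the biset `diag G`. -/
noncomputable def diagHom (G : BisetCat R Z) : (one : BisetCat R Z) ⟶ G.prod G :=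
  ofBiset (diagBiset G)

theorem contractHom_assoc (L H G K : BisetCat R Z) :
    isoHom (assocEquiv (L.prod H) (H.prod G) (G.prod K)) ≫
        prodHom (contractHom L H G) (𝟙 (G.prod K)) ≫ contractHom L G K =
      prodHom (𝟙 (L.prod H)) (contractHom H G K) ≫ contractHom L H K := by
  rw [BisetCat.id_eq, BisetCat.id_eq, contractHom, prodHom_ofBiset, contractHom, contractHom, prodHom_ofBiset,
    contractHom, isoHom, ofBiset_comp, ofBiset_comp, ofBiset_comp]
  exact ofBiset_eq Biset.contract_assoc

theorem contractRightHom_assoc (L H G : BisetCat R Z) :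
    isoHom (assocEquiv (L.prod H) (H.prod G) G) ≫
        prodHom (contractHom L H G) (𝟙 G) ≫ contractRightHom L G =
      prodHom (𝟙 (L.prod H)) (contractRightHom H G) ≫ contractRightHom L H := by
  rw [BisetCat.id_eq, BisetCat.id_eq, contractHom, prodHom_ofBiset, contractRightHom, contractRightHom,
    prodHom_ofBiset, contractRightHom, isoHom, ofBiset_comp, ofBiset_comp, ofBiset_comp]
  exact ofBiset_eq Biset.contractRight_assoc

theorem diag_contract (G K : BisetCat R Z) :
    prodHom (diagHom G) (𝟙 (G.prod K)) ≫ contractHom G G K = isoHom (leftUnitEquiv (G.prod K)) := by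
  rw [BisetCat.id_eq, diagHom, prodHom_ofBiset, contractHom, isoHom, ofBiset_comp]
  exact ofBiset_eq Biset.contract_diag_left

theorem contract_diag (H G : BisetCat R Z) :
    prodHom (𝟙 (H.prod G)) (diagHom G) ≫ contractHom H G G = isoHom (rightUnitEquiv (H.prod G)) := by
  rw [BisetCat.id_eq, diagHom, prodHom_ofBiset, contractHom, isoHom, ofBiset_comp]
  exact ofBiset_eq Biset.contract_diag_right

theorem diag_contractRight (G : BisetCat R Z) :
    prodHom (diagHom G) (𝟙 G) ≫ contractRightHom G G = isoHom (leftUnitEquiv G) := by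
  rw [BisetCat.id_eq, diagHom, prodHom_ofBiset, contractRightHom, isoHom, ofBiset_comp]
  exact ofBiset_eq Biset.contractRight_diag_left

/-- The composition `β ∘ α ∈ A(H × K)` of `β ∈ A(H × G)` and `α ∈ A(G × K)`: the image of
`β × α` under the contraction. -/
noncomputable def comp {H G K : BisetCat R Z} :
    A.obj (H.prod G) →ₗ[R] A.obj (G.prod K) →ₗ[R] A.obj (H.prod K) :=
  A.mul.compr₂ (A.map (contractHom H G K))

/-- The identity element of `G` for the composition: the image of `ε` in `A(G × G)`. -/
noncomputable def ident (G : BisetCat R Z) : A.obj (G.prod G) := A.map (diagHom G) A.unit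

theorem comp_apply {H G K : BisetCat R Z} (b : A.obj (H.prod G)) (a : A.obj (G.prod K)) :
    A.comp b a = A.map (contractHom H G K) (A.mul b a) := rfl

theorem comp_assoc {L H G K : BisetCat R Z} (c : A.obj (L.prod H)) (b : A.obj (H.prod G))
    (a : A.obj (G.prod K)) : A.comp (A.comp c b) a = A.comp c (A.comp b a) := by
  simp only [comp_apply]
  conv_lhs => rw [← A.map_id a, ← A.map_mul, A.mul_assoc]
  conv_rhs => rw [← A.map_id c, ← A.map_mul]
  simp only [BisetFunctor.map_map, ← contractHom_assoc, Category.assoc]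

theorem ident_comp {G K : BisetCat R Z} (a : A.obj (G.prod K)) : A.comp (A.ident G) a = a := by
  rw [comp_apply, ident]
  conv_lhs => rw [← A.map_id a, ← A.map_mul, BisetFunctor.map_map, diag_contract]
  exact (A.unit_mul a).symm

theorem comp_ident {H G : BisetCat R Z} (b : A.obj (H.prod G)) : A.comp b (A.ident G) = b := by
  rw [comp_apply, ident]
  conv_lhs => rw [← A.map_id b, ← A.map_mul, BisetFunctor.map_map, contract_diag]
  exact (A.mul_unit b).symm

/-- The module `A(H × H)`, as an `R`-algebra for the composition. -/
def EndAlg (H : BisetCat R Z) : Type w := A.obj (H.prod H)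

namespace EndAlg

variable {A} {H : BisetCat R Z}

noncomputable instance : AddCommGroup (A.EndAlg H) := inferInstanceAs (AddCommGroup (A.obj (H.prod H)))
noncomputable instance : Module R (A.EndAlg H) := inferInstanceAs (Module R (A.obj (H.prod H)))

noncomputable instance : Mul (A.EndAlg H) := ⟨fun b a => A.comp (H := H) (G := H) (K := H) b a⟩
noncomputable instance : One (A.EndAlg H) := ⟨A.ident H⟩

noncomputable instance : Ring (A.EndAlg H) where
  mul_assoc := A.comp_assoc
  one_mul := A.ident_comp
  mul_one := A.comp_ident
  left_distrib := fun c b a => (A.comp (H := H) (G := H) (K := H) c).map_add b a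
  right_distrib := fun c b a =>
    LinearMap.map_add₂ (A.comp (H := H) (G := H) (K := H)) c b a
  zero_mul := fun a => LinearMap.map_zero₂ (A.comp (H := H) (G := H) (K := H)) a
  mul_zero := fun b => (A.comp (H := H) (G := H) (K := H) b).map_zero
  neg_add_cancel := neg_add_cancel
  sub_eq_add_neg := sub_eq_add_neg
  zsmul := zsmulRec

theorem mul_def (b a : A.EndAlg H) : b * a = A.comp (H := H) (G := H) (K := H) b a := rfl
theorem one_def : (1 : A.EndAlg H) = A.ident H := rfl

noncomputable instance : Algebra R (A.EndAlg H) :=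
  Algebra.ofModule (fun r b a => LinearMap.map_smul₂ (A.comp (H := H) (G := H) (K := H)) r b a)
    (fun r b a => (A.comp (H := H) (G := H) (K := H) b).map_smul r a)

end EndAlg

/-- The submodule `I_A(H)` of `A(H × H)` generated by the `a ∘ b` with `a ∈ A(H × K)`,
`b ∈ A(K × H)` and `K` in the class, of order smaller than that of `H`. -/
noncomputable def smallSubmodule (H : BisetCat R Z) : Submodule R (A.EndAlg H) :=
  Submodule.span R {x | ∃ K : BisetCat R Z, Nat.card K < Nat.card H ∧
    ∃ (a : A.obj (H.prod K)) (b : A.obj (K.prod H)), x = A.comp a b}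

theorem mul_mem_smallSubmodule {H : BisetCat R Z} (c : A.EndAlg H) {x : A.EndAlg H}
    (hx : x ∈ A.smallSubmodule H) : c * x ∈ A.smallSubmodule H := by
  induction hx using Submodule.span_induction with
  | mem x h =>
    obtain ⟨K, hK, a, b, rfl⟩ := h
    exact Submodule.subset_span ⟨K, hK, A.comp c a, b, (A.comp_assoc c a b).symm⟩
  | zero => simp
  | add x y _ _ hx hy => simpa [mul_add] using Submodule.add_mem _ hx hy
  | smul r x _ hx => simpa using Submodule.smul_mem _ r hx

theorem mem_smallSubmodule_mul {H : BisetCat R Z} (c : A.EndAlg H) {x : A.EndAlg H}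
    (hx : x ∈ A.smallSubmodule H) : x * c ∈ A.smallSubmodule H := by
  induction hx using Submodule.span_induction with
  | mem x h =>
    obtain ⟨K, hK, a, b, rfl⟩ := h
    exact Submodule.subset_span ⟨K, hK, a, A.comp b c, A.comp_assoc a b c⟩
  | zero => simp
  | add x y _ _ hx hy => simpa [add_mul] using Submodule.add_mem _ hx hy
  | smul r x _ hx => simpa using Submodule.smul_mem _ r hx

/-- The submodule `I_A(H)` as an ideal. -/
noncomputable def smallIdeal (H : BisetCat R Z) : Ideal (A.EndAlg H) :=
  { A.smallSubmodule H with smul_mem' := fun c _ hx => A.mul_mem_smallSubmodule c hx }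

instance (H : BisetCat R Z) : (A.smallIdeal H).IsTwoSided :=
  ⟨fun c hx => A.mem_smallSubmodule_mul c hx⟩

/-- The quotient algebra `Â(H) = A(H × H) / I_A(H)`. -/
abbrev Hat (H : BisetCat R Z) : Type w := A.EndAlg H ⧸ A.smallIdeal H

end GreenBisetFunctor

namespace GreenModule

open BisetCat

variable {R : Type v} [CommRing R] {Z : GroupClass.{u}} {A : GreenBisetFunctor.{u, v, w} R Z}
variable (M : GreenModule.{u, v, w, w'} A)

/-- The action `M(G) → M(H)` of an element of `A(H × G)`: the image of `α × m` under the
contraction. -/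
noncomputable def apply {H G : BisetCat R Z} :
    A.obj (H.prod G) →ₗ[R] M.obj G →ₗ[R] M.obj H :=
  M.act.compr₂ (M.map (GreenBisetFunctor.contractRightHom H G))

theorem apply_apply {H G : BisetCat R Z} (a : A.obj (H.prod G)) (m : M.obj G) :
    M.apply a m = M.map (GreenBisetFunctor.contractRightHom H G) (M.act a m) := rfl

theorem comp_apply {L H G : BisetCat R Z} (b : A.obj (L.prod H)) (a : A.obj (H.prod G))
    (m : M.obj G) : M.apply (A.comp b a) m = M.apply b (M.apply a m) := by
  simp only [apply_apply, A.comp_apply]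
  conv_lhs => rw [← M.map_id m, ← M.map_act, M.mul_act]
  conv_rhs => rw [← A.map_id b, ← M.map_act]
  simp only [BisetFunctor.map_map, ← GreenBisetFunctor.contractRightHom_assoc, Category.assoc]

theorem ident_apply {G : BisetCat R Z} (m : M.obj G) : M.apply (A.ident G) m = m := by
  rw [apply_apply, GreenBisetFunctor.ident]
  conv_lhs => rw [← M.map_id m, ← M.map_act, BisetFunctor.map_map,
    GreenBisetFunctor.diag_contractRight]
  exact (M.unit_act m).symm

/-- The `A(H × H)`-module structure of `M(H)`. -/
noncomputable instance (H : BisetCat R Z) : SMul (A.EndAlg H) (M.obj H) :=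
  ⟨fun a m => M.apply (H := H) (G := H) a m⟩

theorem smul_def {H : BisetCat R Z} (a : A.EndAlg H) (m : M.obj H) :
    a • m = M.apply (H := H) (G := H) a m := rfl

noncomputable instance (H : BisetCat R Z) : Module (A.EndAlg H) (M.obj H) where
  one_smul m := M.ident_apply m
  mul_smul b a m := M.comp_apply b a m
  smul_zero a := (M.apply (H := H) (G := H) a).map_zero
  smul_add a m n := (M.apply (H := H) (G := H) a).map_add m n
  add_smul b a m := LinearMap.map_add₂ (M.apply (H := H) (G := H)) b a m
  zero_smul m := LinearMap.map_zero₂ (M.apply (H := H) (G := H)) m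

end GreenModule

/-! The point is that a non-zero element of $S(H)$ generates all of $S$ through the action of $A$.
Fix $m\in S(H)$ and consider the family $G\mapsto A(G\times H)\cdot m\subseteq S(G)$. It is a
submodule of $S$, because the dot action absorbs both kinds of operations: $S(\varphi)(a\cdot
m)=A(\varphi\times H)(a)\cdot m$ for a morphism $\varphi$ (`GreenModule.map_apply`), and
$b\times(a\cdot m)=(b\times a)\cdot m$ up to reassociating the groups (`GreenModule.act_apply`). It
contains $m$, by the action of the identity of $A(H\times H)$. If $m\neq0$, simplicity of $S$ forces
this family to be $S$; at $G=H$ this says $A(H\times H)\cdot m=S(H)$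
(`GreenModule.IsSimple.exists_smul_eq`). Thus every non-zero element of $S(H)$ generates it over
$A(H\times H)$, for any $H$, minimal or not.

Minimality enters only through $I_A(H)$. For a generator $b\circ c$ that factors through a smaller
group $K$, one has $(b\circ c)\cdot m=b\cdot(c\cdot m)$ with $c\cdot m\in S(K)=0$, so $I_A(H)$
annihilates $S(H)$ (`GreenModule.smul_eq_zero_of_mem_smallIdeal`). The action therefore descends to
$\hat A(H)$. The orbit of an element is the same for both algebras, which gives simplicity, and an
algebra acting unitally on a non-zero module is itself non-zero.

The two absorption rules are formal consequences of functoriality once two identities between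
morphisms of the biset category are known: the contraction $(G\times H)\times H\to G$ is natural in
$G$ (`contractRightHom_natural`), and it is compatible with taking the product by a further group on
the left (`contractRightHom_prod_left`). Both are checked on explicit bisets, and naturality is then
extended linearly. -/

namespace Biset

/-! ### Isomorphisms of bisets behind the contraction of $H$ -/

section Naturality

variable {G G' H K : Type u} [Group G] [Group G'] [Group H] [Group K]
variable [Finite H]

/-- The biset `U × H` in which both copies of `H` on the right act on `H`, one of them by inverse
left multiplication. -/
def prodContract (U : Biset G' G) (H : Type u) [Group H] [Finite H] :
    Biset G' ((G × H) × H) :=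
  ofFun (U × H) (fun a x => (a • x.1, x.2)) (fun x b => (x.1 <• b.1.1, b.1.2⁻¹ * x.2 * b.2))
    (fun x => by simp) (fun a b x => by simp [mul_smul]) (fun x => by simp)
    (fun x a b => by simp [mul_smul, mul_assoc]) (fun a x b => by simp [smul_comm])

/-- The middle factor $G$ is absorbed by $U$: the isomorphism is $[u,(g,h)]\mapsto(ug,h)$. -/
theorem comp_contractRight [Finite G] (U : Biset G' G) :
    Isom (comp U (contractRight G H)) (prodContract U H) := by
  refine comp_isom' (V := U) (U := contractRight G H) (W := prodContract U H)
    (lV := fun a x => a • x) (rV := fun x b => x <• b)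
    (lU := fun a (x : G × H) => ((a * x.1, x.2) : G × H))
    (rU := fun (x : G × H) b => ((x.1 * b.1.1, b.1.2⁻¹ * x.2 * b.2) : G × H))
    (lW := fun a (x : U × H) => ((a • x.1, x.2) : U × H))
    (rW := fun (x : U × H) b => ((x.1 <• b.1.1, b.1.2⁻¹ * x.2 * b.2) : U × H))
    (fun _ _ => rfl) (fun _ _ => rfl) (fun _ _ => rfl) (fun _ _ => rfl) (fun _ _ => rfl)
    (fun _ _ => rfl)
    (fun x (y : G × H) => ((x <• y.1, y.2) : U × H))
    ?_ ?_ ?_ ?_ ?_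
  · intro v b (y : G × H)
    exact Prod.ext (by simp [mul_smul]) rfl
  · intro a v (y : G × H)
    exact Prod.ext (smul_comm _ _ _).symm rfl
  · intro c v (y : G × H)
    exact Prod.ext (by simp [mul_smul]) rfl
  · intro (w : U × H)
    exact ⟨w.1, ((1, w.2) : G × H), Prod.ext (one_smul Gᵐᵒᵖ w.1) rfl⟩
  · rintro v (⟨g, h⟩ : G × H) v' (⟨g', h'⟩ : G × H) e
    obtain ⟨e1, e2⟩ := Prod.ext_iff.1 e
    dsimp only at e1 e2
    -- The element moving one representative to the other is forced by the coordinate in $G$, on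
    -- which the middle group acts by left translation.
    refine ⟨g * g'⁻¹, ?_, Prod.ext (inv_mul_cancel_right g g').symm e2⟩
    simp only [MulOpposite.op_mul, mul_smul, e1]
    simp

/-- Here $G'$ acts on $U$ from the left, and the two identity bisets $H$ are absorbed by the
contracted copy of $H$: the isomorphism is $[(x,y),((v,h),k)]\mapsto(xv,\,h^{-1}yk)$. Its target is
the same biset as in `comp_contractRight`, which is what yields naturality. -/
theorem contractRight_comp [Finite G'] (U : Biset G' G) :
    Isom (comp (contractRight G' H) (prod (prod U (idBiset H)) (idBiset H)))
      (prodContract U H) := by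
  refine comp_isom' (V := contractRight G' H) (U := prod (prod U (idBiset H)) (idBiset H))
    (W := prodContract U H)
    (lV := fun a (x : G' × H) => ((a * x.1, x.2) : G' × H))
    (rV := fun (x : G' × H) b => ((x.1 * b.1.1, b.1.2⁻¹ * x.2 * b.2) : G' × H))
    (lU := fun a (x : (U × H) × H) =>
      (((a.1.1 • x.1.1, a.1.2 * x.1.2), a.2 * x.2) : (U × H) × H))
    (rU := fun (x : (U × H) × H) b =>
      (((x.1.1 <• b.1.1, x.1.2 * b.1.2), x.2 * b.2) : (U × H) × H))
    (lW := fun a (x : U × H) => ((a • x.1, x.2) : U × H))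
    (rW := fun (x : U × H) b => ((x.1 <• b.1.1, b.1.2⁻¹ * x.2 * b.2) : U × H))
    (fun _ _ => rfl) (fun _ _ => rfl) (fun _ _ => rfl) (fun _ _ => rfl) (fun _ _ => rfl)
    (fun _ _ => rfl)
    (fun (x : G' × H) (y : (U × H) × H) => ((x.1 • y.1.1, y.1.2⁻¹ * x.2 * y.2) : U × H))
    ?_ ?_ ?_ ?_ ?_
  · intro (x : G' × H) b (y : (U × H) × H)
    exact Prod.ext (by simp [mul_smul]) (by simp [mul_assoc])
  · intro a (x : G' × H) (y : (U × H) × H)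
    exact Prod.ext (by simp [mul_smul]) rfl
  · intro c (x : G' × H) (y : (U × H) × H)
    exact Prod.ext (smul_comm _ _ _) (by simp [mul_assoc])
  · intro (w : U × H)
    exact ⟨((1, w.2) : G' × H), (((w.1, 1), 1) : (U × H) × H),
      Prod.ext (one_smul G' w.1) (by simp)⟩
  · rintro (⟨x, y⟩ : G' × H) (⟨⟨v, h⟩, k⟩ : (U × H) × H) (⟨x', y'⟩ : G' × H)
      (⟨⟨v', h'⟩, k'⟩ : (U × H) × H) e
    obtain ⟨e1, e2⟩ := Prod.ext_iff.1 e
    dsimp only at e1 e2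
    -- Each component is forced by a coordinate on which the middle group acts by translation: $x'$
    -- is a right translate of $x$, while $h$ and $k$ are left translates of $h'$ and $k'$. The
    -- hypothesis `e` settles the two remaining coordinates, $y'$ and $v$.
    refine ⟨((x⁻¹ * x', h * h'⁻¹), k * k'⁻¹),
      Prod.ext (mul_inv_cancel_left x x').symm ?_,
      Prod.ext (Prod.ext ?_ (inv_mul_cancel_right h h').symm) (inv_mul_cancel_right k k').symm⟩
    · change y' = (h * h'⁻¹)⁻¹ * y * (k * k'⁻¹)
      -- `e2` only controls $h'^{-1}y'k'$, so $y'$ is rewritten to display that factor.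
      rw [show y' = h' * (h'⁻¹ * y' * k') * k'⁻¹ by group, ← e2]
      group
    · change v = (x⁻¹ * x') • v'
      rw [mul_smul, ← e1, inv_smul_smul]

theorem contractRight_natural [Finite G] [Finite G'] (U : Biset G' G) :
    Isom (comp U (contractRight G H))
      (comp (contractRight G' H) (prod (prod U (idBiset H)) (idBiset H))) :=
  (comp_contractRight U).trans (contractRight_comp U).symm

theorem prod_iso_id [Finite G'] (f : G ≃* G') :
    Isom (prod (iso f) (idBiset H)) (iso (f.prodCongr (MulEquiv.refl H))) :=
  ⟨Equiv.refl (G' × H), fun _ _ => rfl, fun _ _ => rfl⟩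

theorem iso_comp_iso [Finite K] (f : G ≃* H) (g : H ≃* K) :
    Isom (comp (iso g) (iso f)) (iso (f.trans g)) :=
  comp_iso (iso g) (iso (f.trans g)) f (Equiv.refl K) (fun _ _ => rfl) (fun _ _ => rfl)

/-- Contracting $H$ does not touch the factors to its left, so multiplying by $G$ before or after
the contraction differs only by bracketing. The two reassociations merge into one group isomorphism
(`prod_iso_id`, `iso_comp_iso`), and composing with the biset of an isomorphism only relabels the
right action (`comp_iso`). What is left is the rebracketing $(G\times K)\times H\to G\times(K\times
H)$ of the underlying sets. -/
theorem contractRight_prod_left [Finite G] [Finite K] :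
    Isom (comp (comp (contractRight (G × K) H)
        (prod (iso (MulEquiv.prodAssoc : (G × K) × H ≃* G × (K × H)).symm) (idBiset H)))
        (iso (MulEquiv.prodAssoc : (G × (K × H)) × H ≃* G × ((K × H) × H)).symm))
      (prod (idBiset G) (contractRight K H)) :=
  (comp_assoc _ _ _).trans <|
    (comp_congr (Isom.refl _)
      ((comp_congr (prod_iso_id _) (Isom.refl _)).trans (iso_comp_iso _ _))).trans
    (comp_iso (contractRight (G × K) H) (prod (idBiset G) (contractRight K H)) _
      (Equiv.prodAssoc G K H) (fun _ _ => rfl) (fun _ _ => rfl))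

end Naturality

end Biset

/-! ### The contraction as a morphism of the biset category -/

namespace GreenBisetFunctor

open BisetCat

variable {R : Type v} [CommRing R] {Z : GroupClass.{u}}

/-- Both sides are $R$-linear in $\varphi$, so it is enough to treat a morphism given by a single
biset, where `Biset.contractRight_natural` applies. -/
theorem contractRightHom_natural {G G' : BisetCat R Z} (H : BisetCat R Z) (φ : G ⟶ G') :
    contractRightHom G H ≫ φ =
      prodHom (prodHom φ (𝟙 H)) (𝟙 H) ≫ contractRightHom G' H := by
  -- The two sides are packaged as linear maps of $\varphi$; `RB.comp` takes the morphism applied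
  -- last as its first argument, hence the `flip`.
  let lhs : RB R G' G →ₗ[R] RB R G' ((G.prod H).prod H) :=
    (RB.comp R G' G ((G.prod H).prod H)).flip (contractRightHom G H)
  let rhs : RB R G' G →ₗ[R] RB R G' ((G.prod H).prod H) :=
    RB.comp R G' ((G'.prod H).prod H) ((G.prod H).prod H) (contractRightHom G' H) ∘ₗ
      (RB.prod R (G'.prod H) (G.prod H) H H).flip (𝟙 H) ∘ₗ (RB.prod R G' G H H).flip (𝟙 H)
  have key : lhs = rhs := RB.hom_ext fun U => by
    change contractRightHom G H ≫ (ofBiset U : G ⟶ G') =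
      prodHom (prodHom (ofBiset U) (𝟙 H)) (𝟙 H) ≫ contractRightHom G' H
    rw [BisetCat.id_eq, prodHom_ofBiset, prodHom_ofBiset, contractRightHom, contractRightHom,
      ofBiset_comp, ofBiset_comp]
    exact ofBiset_eq (Biset.contractRight_natural U)
  exact LinearMap.congr_fun key φ

theorem contractRightHom_prod_left (G K H : BisetCat R Z) :
    isoHom (assocEquiv G (K.prod H) H) ≫
        prodHom (isoHom (assocEquiv G K H)) (𝟙 H) ≫ contractRightHom (G.prod K) H =
      prodHom (𝟙 G) (contractRightHom K H) := by
  rw [BisetCat.id_eq, BisetCat.id_eq, isoHom, isoHom, contractRightHom, contractRightHom,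
    prodHom_ofBiset, prodHom_ofBiset, ofBiset_comp, ofBiset_comp]
  exact ofBiset_eq Biset.contractRight_prod_left

end GreenBisetFunctor

/-! ### Submodules generated by one element, and the annihilation by $I_A(H)$ -/

namespace GreenModule

open BisetCat GreenBisetFunctor

variable {R : Type v} [CommRing R] {Z : GroupClass.{u}} {A : GreenBisetFunctor.{u, v, w} R Z}
variable (M : GreenModule.{u, v, w, w'} A)

/-- Gives stability of the family $A(G\times H)\cdot m$ under morphisms. Functoriality of the
product moves $\varphi\times H$ outside, applied together with the identity on $m$, and naturality
of the contraction concludes. -/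
theorem map_apply {G G' H : BisetCat R Z} (φ : G ⟶ G') (a : A.obj (G.prod H)) (m : M.obj H) :
    M.map φ (M.apply a m) = M.apply (A.map (prodHom φ (𝟙 H)) a) m := by
  simp only [apply_apply]
  conv_rhs => rw [← M.map_id m, ← M.map_act]
  simp only [BisetFunctor.map_map, contractRightHom_natural]

/-- Gives stability of the family $A(G\times H)\cdot m$ under products with $A$. Both sides become
images of $b\times(a\times m)$, the right one by associativity of the action; the two morphisms
applied to it agree by `contractRightHom_prod_left`. -/
theorem act_apply {G K H : BisetCat R Z} (b : A.obj G) (a : A.obj (K.prod H)) (m : M.obj H) :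
    M.act b (M.apply a m) = M.apply (A.map (isoHom (assocEquiv G K H)) (A.mul b a)) m := by
  simp only [apply_apply]
  conv_rhs => rw [← M.map_id m, ← M.map_act, M.mul_act]
  conv_lhs => rw [← A.map_id b, ← M.map_act]
  simp only [BisetFunctor.map_map, Category.assoc, contractRightHom_prod_left]

/-- The submodule of `M` generated by an element `m ∈ M(H)`. -/
noncomputable def cyclic {H : BisetCat R Z} (m : M.obj H) : GreenSubmodule M where
  -- No span is needed: with $m$ fixed, $a\cdot m$ is linear in $a$, so these elements already form
  -- an $R$-submodule.
  obj G := LinearMap.range ((M.apply (H := G) (G := H)).flip m)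
  map_mem := by
    rintro G G' φ _ ⟨a, rfl⟩
    exact ⟨_, (M.map_apply φ a m).symm⟩
  act_mem := by
    rintro G K b _ ⟨a, rfl⟩
    exact ⟨_, (M.act_apply b a m).symm⟩

theorem mem_cyclic {G H : BisetCat R Z} {m : M.obj H} {x : M.obj G} :
    x ∈ (M.cyclic m).obj G ↔ ∃ a : A.obj (G.prod H), M.apply a m = x := Iff.rfl

/-- The submodule generated by $m$ contains $m$ itself, so it is not zero; by simplicity it is
everything, in particular at $H$. -/
theorem IsSimple.exists_smul_eq {M : GreenModule.{u, v, w, w'} A} (hM : M.IsSimple)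
    {H : BisetCat R Z} {m : M.obj H} (hm : m ≠ 0) (x : M.obj H) :
    ∃ a : A.EndAlg H, a • m = x := by
  have h : m ∈ (M.cyclic m).obj H := M.mem_cyclic.2 ⟨A.ident H, M.ident_apply m⟩
  rcases hM.2 (M.cyclic m) with h' | h'
  · rw [h', Submodule.mem_bot] at h
    exact absurd h hm
  · exact M.mem_cyclic.1 (h' H ▸ Submodule.mem_top)

/-- A generator of $I_A(H)$ acts on $M(H)$ through some $M(K)$ with $|K|<|H|$, and that module
vanishes. -/
theorem smul_eq_zero_of_mem_smallIdeal {H : BisetCat R Z}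
    (hH : ∀ K : BisetCat R Z, Nat.card K < Nat.card H → Subsingleton (M.obj K))
    {a : A.EndAlg H} (ha : a ∈ A.smallIdeal H) (m : M.obj H) : a • m = 0 := by
  -- The annihilator of $m$ is the kernel of an $R$-linear map, and $I_A(H)$ is an $R$-span, so the
  -- generators suffice.
  have h : A.smallSubmodule H ≤
      LinearMap.ker (show A.EndAlg H →ₗ[R] M.obj H from (M.apply (H := H) (G := H)).flip m) := by
    refine Submodule.span_le.2 ?_
    rintro _ ⟨K, hK, b, c, rfl⟩
    have := hH K hK
    change M.apply (A.comp b c) m = 0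
    rw [M.comp_apply, Subsingleton.elim (M.apply c m) 0, map_zero]
  exact h ha

end GreenModule

/-! ### Simplicity of $S(H)$ over $\hat A(H)$ -/

theorem lemma2p10 {R : Type v} [CommRing R] {Z : GroupClass.{u}}
    (A : GreenBisetFunctor.{u, v, w} R Z) (S : GreenModule.{u, v, w, w'} A) (hS : S.IsSimple)
    (H : BisetCat R Z) (hH : S.toBisetFunctor.IsMinimal H) :
    Nontrivial (A.Hat H) ∧
      ∃ _ : Module (A.Hat H) (S.obj H),
        (∀ (a : A.EndAlg H) (s : S.obj H), Ideal.Quotient.mk (A.smallIdeal H) a • s = a • s) ∧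
          IsSimpleModule (A.Hat H) (S.obj H) := by
  have hnt : Nontrivial (S.obj H) := hH.1
  have htors : Module.IsTorsionBySet (A.EndAlg H) (S.obj H) (A.smallIdeal H) :=
    fun m a => S.smul_eq_zero_of_mem_smallIdeal hH.2 a.2 m
  let inst : Module (A.Hat H) (S.obj H) := htors.module
  -- Over the zero ring $1=0$ would kill every module, so $S(H)\neq0$ gives $\hat A(H)\neq0$. The
  -- compatibility holds by definition, since a class acts through any representative.
  refine ⟨Module.nontrivial (A.Hat H) (S.obj H), inst, fun a s => rfl, ?_⟩
  -- Simplicity in the form: the module is non-zero and each non-zero element generates it. A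
  -- coefficient found in $A(H\times H)$ is then reduced modulo $I_A(H)$.
  refine isSimpleModule_iff_toSpanSingleton_surjective.2 ⟨hnt, fun m hm x => ?_⟩
  obtain ⟨a, rfl⟩ := hS.exists_smul_eq hm x
  exact ⟨Ideal.Quotient.mk (A.smallIdeal H) a, rfl⟩
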